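/- Let $m\ge 3$ be an integer and let $K$ be a field. An $A$-partition is a set partition of $\{1,\dots,m\}$ into $m-1$ parts, and a $B$-partition is a set partition of $\{1,\dots,m\}$ into $2$ parts. Let $V_m$ be the $K$-vector space with basis the formal monomials $AB$, where $A$ is an $A$-partition and $B$ is a $B$-partition. For a finite undirected graph $G$ (loops and parallel edges allowed, with one variable $a_e$ for each edge $e$) with $m$ distinct marked vertices $v_1,\dots,v_m$, and a set partition $P$ of $\{1,\dots,m\}$, the spanning forest polynomial is $\Phi_G(P)=\sum_F\prod_{e\notin F}a_e$. Here $F$ runs over the spanning forests of $G$ (isolated vertices count as trees) for which there is a bijection between the trees of $F$ and the parts of $P$ such that each $v_i$ lies in the tree corresponding to the part of $i$. Let $X_m\subseteq V_m$ be the subspace of all $\sum\alpha_{A,B}\,AB$ such that $\sum\alpha_{A,B}\,\Phi_G(A)\,\Phi_G(B)=0$ for every such $G$. For $U,W\subseteq\{1,\dots,m\}$ with $|U|=|W|$ and a set partition $P$ of $\{1,\dots,m\}$, put $$\varepsilon_{U,W}(P)=(-1)^{\sum_{u\in U}u+\sum_{w\in W}w}\,\operatorname{sgn}(\pi)$$ if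 each part of $P$ contains exactly one element of $U$ and exactly one element of $W$, where $\pi:U\to W$ is the bijection given by the parts of $P$ and $\operatorname{sgn}(\pi)=\pm1$ is the parity of its number of inversions; otherwise put $\varepsilon_{U,W}(P)=0$. By the all minors matrix tree theorem, this is the coefficient of the forests with marked-vertex partition $P$ in $\det L_{U,W}$, where $L$ is the graph Laplacian and the subscripts list the removed rows and columns. For $c\in\{1,\dots,m\}$ and $1\le i\le m-1$ let $i^{(c)}=i$ if $i<c$ and $i^{(c)}=i+1$ if $i\ge c$. For $r,c\in\{1,\dots,m\}$ and $1\le j\le m-1$ define $$L_{r,c}(j)=(-1)^{r+c}\sum_{A,B}\ \sum_{i=1}^{m-1}(-1)^{i+j}\;\varepsilon_{[m]\setminus\{i^{(r)}\},\,[m]\setminus\{j^{(c)}\}}(A)\;\varepsilon_{\{i^{(r)},r\},\,\{j^{(c)},c\}}(B)\;AB\ \in V_m .$$ This is the right-hand side of the column expansion identity $$\det M\,\det M_{[k],[k]}=\sum_{i=1}^{k}(-1)^{i+j}\det M_{i,j}\,\det M_{[k]\setminus\{i\},[k]\setminus\{j\}},\qquad k=m-1,\quad M=L_{r,c},$$ with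 its minors expanded in set partitions, and normalized by $(-1)^{r+c}$ so that the left-hand side becomes the product of the polynomials of the partition with one part and of the partition with $m$ parts. Then the $m(m-2)$ elements $$L_{m,i}(j)-L_{m,m}(m-1),\qquad 1\le i\le m,\quad 1\le j\le m-2,$$ are linearly independent in $V_m$. Moreover they all lie in $X_m$, and hence are linearly independent in $X_m$. -/

import Mathlib

/-- A finite undirected graph, loops and parallel edges allowed, with `m` distinct marked
vertices `mark 0, …, mark (m - 1)`; `ends e` is the unordered pair of end vertices of `e`. -/
structure MarkedGraph (m : ℕ) where
  Vert : Type
  Edge : Type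
  [fintypeVert : Fintype Vert]
  [fintypeEdge : Fintype Edge]
  ends : Edge → Sym2 Vert
  mark : Fin m ↪ Vert

attribute [instance] MarkedGraph.fintypeVert MarkedGraph.fintypeEdge

namespace MarkedGraph

variable {m : ℕ} (G : MarkedGraph m)

/-- The simple graph on all vertices of `G` in which two distinct vertices are adjacent
when an edge in `F` joins them. -/
def spanned (F : Finset G.Edge) : SimpleGraph G.Vert :=
  SimpleGraph.fromEdgeSet (G.ends '' (F : Set G.Edge))

/-- `F` contains no cycle: no loop (a cycle of length 1), no two parallel edges (a cycle of
length 2), and no cycle of length at least 3. Isolated vertices are trees of the forest. -/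
def IsSpanningForest (F : Finset G.Edge) : Prop :=
  (∀ e ∈ F, ¬ (G.ends e).IsDiag) ∧ Set.InjOn G.ends (F : Set G.Edge) ∧ (G.spanned F).IsAcyclic

/-- There is a bijection between the trees of `F` and the parts (equivalence classes) of the
set partition `P` of the marked vertices, such that each marked vertex is in the tree
corresponding to its part. -/
def Compatible (F : Finset G.Edge) (P : Setoid (Fin m)) : Prop :=
  ∃ φ : (G.spanned F).ConnectedComponent ≃ Quotient P,
    ∀ i : Fin m, φ ((G.spanned F).connectedComponentMk (G.mark i)) = Quotient.mk P i

open scoped Classical in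
/-- The spanning forest polynomial `∑_{F ∼ P} ∏_{e ∉ F} a_e` of `G` and the partition `P`. -/
noncomputable def forestPoly (K : Type*) [Field K] (P : Setoid (Fin m)) :
    MvPolynomial G.Edge K :=
  ∑ F : Finset G.Edge with G.IsSpanningForest F ∧ G.Compatible F P,
    ∏ e ∈ Fᶜ, MvPolynomial.X e

end MarkedGraph

/-- The set partitions of the `m` marked vertices with exactly `k` parts. A set partition is
represented by the equivalence relation "in the same part". -/
abbrev PartitionsInto (m k : ℕ) : Type := {P : Setoid (Fin m) // Nat.card (Quotient P) = k}

instance finite_setoid_fin (m : ℕ) : Finite (Setoid (Fin m)) :=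
  Finite.of_injective (fun P : Setoid (Fin m) => fun x y => P x y) fun _ _ h =>
    Setoid.ext fun x y => iff_of_eq (congrFun (congrFun h x) y)

/-- The vector space `V_m` with basis the monomials `A B`, where `A` is a set partition of the
marked vertices into `m - 1` parts and `B` one into `2` parts. The two factors play different
roles, also for `m = 3`. -/
abbrev ABSpace (K : Type*) [Field K] (m : ℕ) : Type _ :=
  (PartitionsInto m (m - 1) × PartitionsInto m 2) →₀ K

/-- The linear map on `V_m` that replaces each of the partitions `A`, `B` by its spanning forest
polynomial on `G`. -/
noncomputable def ABSpace.eval (K : Type*) [Field K] {m : ℕ} (G : MarkedGraph m) :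
    ABSpace K m →ₗ[K] MvPolynomial G.Edge K :=
  Finsupp.linearCombination K fun p => G.forestPoly K p.1.1 * G.forestPoly K p.2.1

/-- The subspace `X_m` of `V_m`: the combinations of monomials `A B` that vanish on every graph
with `m` marked vertices. -/
noncomputable def identitySpace (K : Type*) [Field K] (m : ℕ) : Submodule K (ABSpace K m) :=
  ⨅ G : MarkedGraph m, LinearMap.ker (ABSpace.eval K G)

/-- Suppose that every part of `P` contains exactly one element of `U` and exactly one element of
`W`, so that `P` defines a bijection `U → W`. This is the number of inversions of that bijection,
for the natural orders on `U` and `W`. -/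
noncomputable def inversions {m : ℕ} (U W : Finset (Fin m)) (P : Setoid (Fin m)) : ℕ :=
  Nat.card {t : (U × W) × (U × W) //
    P t.1.1 t.1.2 ∧ P t.2.1 t.2.2 ∧ t.1.1 < t.2.1 ∧ t.2.2 < t.1.2}

open scoped Classical in
/-- Let `L` be the Laplacian of a graph in which the marked vertices come first, and let `L_{U,W}`
be `L` with the rows in `U` and the columns in `W` removed, where `U`, `W` are sets of marked
vertices of the same size. The determinant of `L_{U,W}` is a signed sum of spanning forests in
which each tree contains exactly one vertex of `U` and exactly one vertex of `W`; the sign of a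
forest is `(-1) ^ (∑ U + ∑ W)` times the sign of the bijection `U → W` given by its trees.
`minorCoeff U W P` is the resulting coefficient in `det L_{U,W}` of the forests compatible with
the partition `P` of the marked vertices. (Counting vertices from `0` instead of from `1` does
not change the sign, as `U` and `W` have the same size.) -/
noncomputable def minorCoeff {m : ℕ} (U W : Finset (Fin m)) (P : Setoid (Fin m)) : ℤ :=
  if (∀ x, ∃! u, u ∈ U ∧ P u x) ∧ (∀ x, ∃! w, w ∈ W ∧ P w x) then
    (-1) ^ (∑ u ∈ U, (u : ℕ) + ∑ w ∈ W, (w : ℕ)) * (-1) ^ inversions U W P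
  else 0

/-- The row (or column) of a matrix with `m` rows that is in position `i` once row `c` has been
removed. -/
def skip {m : ℕ} (c : Fin m) (i : Fin (m - 1)) : Fin m :=
  if (i : ℕ) < c then ⟨i, by omega⟩ else ⟨i + 1, by omega⟩

/-- `L_{r,c}(j)` as an element of `V_m`. With `M = L_{r,c}` (the Laplacian with row `r` and column
`c` removed) and `k = m - 1`, this is the right-hand side of the `j`-th column expansion identity
`det M * det M_{[k],[k]} = ∑ i, (-1)^(i+j) * det M_{i,j} * det M_{[k] \ i, [k] \ j}`,
each minor of the Laplacian being read as a signed sum of set partitions: the second determinant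
gives the partition `A`, the first one the partition `B`. As `det M` is `(-1)^(r+c)` times
the spanning tree polynomial `(1,1,…,1)`, both sides are multiplied by `(-1)^(r+c)`, so that
the left-hand side of the identity is `(1,1,…,1)(1,2,…,m)`. -/
noncomputable def columnRHS (K : Type*) [Field K] {m : ℕ} (r c : Fin m) (j : Fin (m - 1)) :
    ABSpace K m :=
  Finsupp.equivFunOnFinite.symm fun p =>
    (((-1) ^ ((r : ℕ) + (c : ℕ)) * ∑ i : Fin (m - 1), (-1) ^ ((i : ℕ) + (j : ℕ)) *
      minorCoeff (Finset.univ.erase (skip r i)) (Finset.univ.erase (skip c j)) p.1.1 *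
      minorCoeff {skip r i, r} {skip c j, c} p.2.1 : ℤ) : K)

/-- The element `L_{m,c}(j) - L_{m,m}(m-1)` of `V_m` for `1 ≤ c ≤ m` and `1 ≤ j ≤ m - 2`; in the
code the rows, columns and positions are counted from `0`. -/
noncomputable def columnDiff (K : Type*) [Field K] {m : ℕ} (hm : 3 ≤ m) (c : Fin m)
    (j : Fin (m - 2)) : ABSpace K m :=
  columnRHS K ⟨m - 1, by omega⟩ c ⟨j, by omega⟩ -
    columnRHS K ⟨m - 1, by omega⟩ ⟨m - 1, by omega⟩ ⟨m - 2, by omega⟩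

/-! Let `r` be the last vertex and `b = skip c j`. In `columnRHS K r c j` all signs cancel: the
coefficient of `A B` is 1 if `A` joins `b` to some other vertex `a` and `B` separates `b` from both
`a` and `c`, and 0 otherwise (`columnRHS_apply`). Each element thus corresponds to a pair `b ≠ c`.

Membership: on a graph the element becomes the sum over `a ≠ b` of (forests joining only `a` and
`b`) times (two-tree forests separating `b` from `a` and `c`), and this must not depend on `b` and
`c`. Dividing by the product of the edge variables turns forest polynomials into sums over rooted
forests with weights `1 / a_e`. Counted by the root whose tree contains a given vertex, these are
unnormalised hitting probabilities, harmonic off the roots; this follows from Kirchhoff's law for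
the tree path in each single forest (`sum_conductance_mul_flow`). The first factor is then an entry
of the response matrix of the network, the second a potential vanishing at `b`. Their contraction is
a current at `b`, equal to the sum over forests rooted at all marks times the sum over spanning
trees (`sum_hitSum_mul_hitSum`).

Independence: differences of single coefficients give functionals dual to the pairs `(b, d)` with `b
≠ r` (`exists_dual_columnRHS`). The subtracted element belongs to the one such pair that is not
indexed, so these functionals vanish on it. -/

namespace SimpleGraph

/-! ### Paths in forests as unit flows. -/

variable {V : Type*} {H : SimpleGraph V}

theorem IsAcyclic.not_reachable_deleteEdges (hH : H.IsAcyclic) {b v : V} (h : H.Adj b v) :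
    ¬ (H.deleteEdges {s(b, v)}).Reachable b v :=
  isBridge_iff.1 (isAcyclic_iff_forall_adj_isBridge.1 hH h)

/-- In a forest, a path from `x` to `a` traverses the edge `b v` from `b` to `v` if and only if
deleting this edge leaves `b` connected to `x` and `v` connected to `a`. -/
theorem IsAcyclic.mem_darts_iff (hH : H.IsAcyclic) {b v : V} (h : H.Adj b v) {x a : V}
    (p : H.Walk x a) (hp : p.IsPath) :
    (b, v) ∈ p.darts.map Dart.toProd ↔
      (H.deleteEdges {s(b, v)}).Reachable b x ∧ (H.deleteEdges {s(b, v)}).Reachable v a := by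
  have hbr := hH.not_reachable_deleteEdges h
  induction p with
  | nil =>
    simp only [Walk.darts_nil, List.map_nil, List.not_mem_nil, false_iff]
    rintro ⟨h1, h2⟩
    exact hbr (h1.trans h2.symm)
  | @cons x y a hxy q ih =>
    obtain ⟨hq, hx⟩ := (Walk.cons_isPath_iff hxy q).1 hp
    have ih := ih hq
    have hmem : ∀ {s t : V}, s(s, t) ∈ q.edges → s ≠ x ∧ t ≠ x := by
      intro s t hst
      exact ⟨fun e => hx (e ▸ q.fst_mem_support_of_mem_edges hst),
        fun e => hx (e ▸ q.snd_mem_support_of_mem_edges hst)⟩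
    simp only [Walk.darts_cons, List.map_cons, List.mem_cons]
    constructor
    · rintro (heq | hq')
      · obtain ⟨rfl, rfl⟩ := Prod.mk.inj heq
        refine ⟨Reachable.refl _, reachable_deleteEdges_iff_exists_walk.2 ⟨q, fun he => ?_⟩⟩
        exact (hmem he).1 rfl
      · obtain ⟨h1, h2⟩ := ih.1 hq'
        refine ⟨h1.trans (Adj.reachable ?_), h2⟩
        rw [deleteEdges_adj]
        refine ⟨hxy.symm, fun he => ?_⟩
        have hbv : s(b, v) ∈ q.edges := by
          rw [Walk.edges_eq_map_darts]
          obtain ⟨d, hd, hde⟩ := List.mem_map.1 hq'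
          exact List.mem_map.2 ⟨d, hd, by rw [Dart.edge, hde]⟩
        rw [Set.mem_singleton_iff] at he
        rw [← he] at hbv
        exact (hmem hbv).2 rfl
    · rintro ⟨h1, h2⟩
      by_cases he : s(x, y) = s(b, v)
      · rcases Sym2.eq_iff.1 he with ⟨rfl, rfl⟩ | ⟨rfl, rfl⟩
        · exact Or.inl rfl
        · exact absurd h1 hbr
      · refine Or.inr (ih.2 ⟨h1.trans (Adj.reachable ?_), h2⟩)
        rw [deleteEdges_adj]
        exact ⟨hxy, he⟩

open scoped Classical in
/-- A path from `x` to `a` carries a unit flow from `x` to `a`. -/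
theorem Walk.IsPath.sum_darts [Fintype V] {R : Type*} [Ring R] {x a : V} {p : H.Walk x a}
    (hp : p.IsPath) (b : V) :
    ∑ v, ((if (b, v) ∈ p.darts.map Dart.toProd then (1 : R) else 0) -
      (if (v, b) ∈ p.darts.map Dart.toProd then 1 else 0)) =
      (if b = x then 1 else 0) - (if b = a then 1 else 0) := by
  induction p with
  | nil => simp
  | @cons x y a hxy q ih =>
    obtain ⟨hq, hx⟩ := (Walk.cons_isPath_iff hxy q).1 hp
    have ih := ih hq
    have hnot : (x, y) ∉ q.darts.map Dart.toProd := by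
      intro h
      obtain ⟨d, hd, hde⟩ := List.mem_map.1 h
      have := q.dart_fst_mem_support_of_mem_darts hd
      rw [show d.fst = x from congrArg Prod.fst hde] at this
      exact hx this
    have key : ∀ s t : V, (if (s, t) ∈ (cons hxy q).darts.map Dart.toProd then (1 : R) else 0) =
        (if s = x ∧ t = y then 1 else 0) + (if (s, t) ∈ q.darts.map Dart.toProd then 1 else 0) := by
      intro s t
      simp only [Walk.darts_cons, List.map_cons, List.mem_cons, Prod.mk.injEq]
      by_cases h1 : s = x ∧ t = y
      · obtain ⟨rfl, rfl⟩ := h1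
        rw [if_neg hnot]
        simp
      · simp only [h1, false_or, if_false, zero_add]
    simp only [key, add_sub_add_comm, Finset.sum_add_distrib, ih]
    have h1 : ∑ v, ((if b = x ∧ v = y then (1 : R) else 0) - (if v = x ∧ b = y then 1 else 0)) =
        (if b = x then 1 else 0) - (if b = y then 1 else 0) := by
      rw [Finset.sum_sub_distrib]
      congr 1
      · by_cases h : b = x <;> simp [h]
      · by_cases h : b = y <;> simp [h]
    rw [h1]
    abel

open scoped Classical in
/-- The unit flow from `x` to `a` along a forest satisfies Kirchhoff's law. -/
theorem IsAcyclic.sum_flow [Fintype V] {R : Type*} [Ring R] (hH : H.IsAcyclic) {x a b : V}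
    (hxa : H.Reachable x a) (hb : b ≠ a) :
    ∑ v, (if H.Adj b v then
      ((if (H.deleteEdges {s(b, v)}).Reachable b x ∧ (H.deleteEdges {s(b, v)}).Reachable v a
          then (1 : R) else 0) -
        (if (H.deleteEdges {s(b, v)}).Reachable v x ∧ (H.deleteEdges {s(b, v)}).Reachable b a
          then 1 else 0)) else 0) = if b = x then 1 else 0 := by
  obtain ⟨p, hp⟩ := hxa.exists_isPath
  have := hp.sum_darts (R := R) b
  rw [if_neg hb, sub_zero] at this
  rw [← this]
  refine Finset.sum_congr rfl fun v _ => ?_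
  by_cases h : H.Adj b v
  · rw [if_pos h]
    have h1 := hH.mem_darts_iff h p hp
    have h2 := hH.mem_darts_iff h.symm p hp
    rw [Sym2.eq_swap] at h2
    simp only [h1, h2]
  · have h1 : ∀ s t : V, ¬ H.Adj s t → (s, t) ∉ p.darts.map Dart.toProd := by
      intro s t hst hmem
      obtain ⟨d, -, hd⟩ := List.mem_map.1 hmem
      have := d.adj
      rw [hd] at this
      exact hst this
    rw [if_neg h, if_neg (h1 _ _ h), if_neg (h1 _ _ fun h' => h h'.symm), sub_zero]

/-- Reachability after adding an edge. -/
theorem reachable_sup_edge_iff {p q u v : V} :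
    (H ⊔ edge p q).Reachable u v ↔ H.Reachable u v ∨ (H.Reachable u p ∧ H.Reachable q v) ∨
      (H.Reachable u q ∧ H.Reachable p v) := by
  constructor
  · rintro ⟨w⟩
    induction w with
    | nil => exact Or.inl (Reachable.refl _)
    | @cons u y v huy _ ih =>
      rw [sup_adj, edge_adj] at huy
      rcases huy with h | ⟨⟨rfl, rfl⟩ | ⟨rfl, rfl⟩, -⟩
      · have h := h.reachable
        rcases ih with ih | ⟨i1, i2⟩ | ⟨i1, i2⟩
        · exact Or.inl (h.trans ih)
        · exact Or.inr (Or.inl ⟨h.trans i1, i2⟩)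
        · exact Or.inr (Or.inr ⟨h.trans i1, i2⟩)
      · rcases ih with ih | ⟨i1, i2⟩ | ⟨i1, i2⟩
        · exact Or.inr (Or.inl ⟨Reachable.refl _, ih⟩)
        · exact Or.inr (Or.inl ⟨Reachable.refl _, i2⟩)
        · exact Or.inl i2
      · rcases ih with ih | ⟨i1, i2⟩ | ⟨i1, i2⟩
        · exact Or.inr (Or.inr ⟨Reachable.refl _, ih⟩)
        · exact Or.inl i2
        · exact Or.inr (Or.inr ⟨Reachable.refl _, i2⟩)
  · have hpq : (H ⊔ edge p q).Reachable p q := by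
      by_cases h : p = q
      · exact h ▸ Reachable.refl _
      · exact Adj.reachable (Or.inr ((edge_adj ..).2 ⟨Or.inl ⟨rfl, rfl⟩, h⟩))
    have hm : ∀ {s t}, H.Reachable s t → (H ⊔ edge p q).Reachable s t :=
      fun h => h.mono le_sup_left
    rintro (h | ⟨h1, h2⟩ | ⟨h1, h2⟩)
    · exact hm h
    · exact (hm h1).trans (hpq.trans (hm h2))
    · exact (hm h1).trans (hpq.symm.trans (hm h2))

end SimpleGraph

/-! ### Rooted spanning forests and Kirchhoff's law. -/

namespace MarkedGraph

variable {m : ℕ} (G : MarkedGraph m)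

/-- `F` is a spanning forest each tree of which contains exactly one vertex of `S`. -/
def IsRooted (S : Set G.Vert) (F : Finset G.Edge) : Prop :=
  G.IsSpanningForest F ∧ ∀ v, ∃! s, s ∈ S ∧ (G.spanned F).Reachable s v

variable {G}

open scoped Classical in
theorem spanned_insert {e : G.Edge} {p q : G.Vert} (he : G.ends e = s(p, q))
    (F : Finset G.Edge) : G.spanned (insert e F) = G.spanned F ⊔ SimpleGraph.edge p q := by
  rw [spanned, spanned, SimpleGraph.edge, ← SimpleGraph.fromEdgeSet_union, Finset.coe_insert,
    Set.image_insert_eq, he, Set.insert_eq, Set.union_comm]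

open scoped Classical in
-- Deleting an adjacency removes all parallel edges at once, so injectivity of `ends` on `F` is what
-- makes it the removal of `e` alone.
theorem spanned_erase {e : G.Edge} {F : Finset G.Edge} (heF : e ∈ F)
    (hF : Set.InjOn G.ends (F : Set G.Edge)) :
    G.spanned (F.erase e) = (G.spanned F).deleteEdges {G.ends e} := by
  ext u v
  simp only [spanned, SimpleGraph.deleteEdges_adj, SimpleGraph.fromEdgeSet_adj, Set.mem_image,
    Finset.mem_coe, Finset.mem_erase, Set.mem_singleton_iff]
  constructor
  · rintro ⟨⟨f, ⟨hfe, hfF⟩, hf⟩, huv⟩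
    exact ⟨⟨⟨f, hfF, hf⟩, huv⟩, fun h => hfe (hF hfF heF (hf.trans h))⟩
  · rintro ⟨⟨⟨f, hfF, hf⟩, huv⟩, hne⟩
    refine ⟨⟨f, ⟨?_, hfF⟩, hf⟩, huv⟩
    rintro rfl
    exact hne hf.symm

theorem spanned_adj_of_mem {e : G.Edge} {F : Finset G.Edge} (heF : e ∈ F) {p q : G.Vert}
    (he : G.ends e = s(p, q)) (hpq : p ≠ q) : (G.spanned F).Adj p q :=
  (SimpleGraph.fromEdgeSet_adj _).2 ⟨⟨e, heF, he⟩, hpq⟩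

open scoped Classical in
-- A loop, a parallel edge and a longer cycle arise in the same way: the ends of the new edge were
-- already connected.
theorem isSpanningForest_insert {e : G.Edge} {F : Finset G.Edge} (heF : e ∉ F) {p q : G.Vert}
    (he : G.ends e = s(p, q)) :
    G.IsSpanningForest (insert e F) ↔
      G.IsSpanningForest F ∧ ¬ (G.spanned F).Reachable p q := by
  constructor
  · rintro ⟨h1, h2, h3⟩
    have hpq : p ≠ q := by
      have := h1 e (Finset.mem_insert_self _ _)
      rwa [he, Sym2.mk_isDiag_iff] at this
    refine ⟨⟨fun f hf => h1 f (Finset.mem_insert_of_mem hf),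
      h2.mono (by simp), h3.anti ?_⟩, ?_⟩
    · rw [spanned_insert he]
      exact le_sup_left
    · have := h3.not_reachable_deleteEdges
        (spanned_adj_of_mem (Finset.mem_insert_self e F) he hpq)
      rwa [← he, ← spanned_erase (Finset.mem_insert_self e F) h2,
        Finset.erase_insert heF] at this
  · rintro ⟨⟨h1, h2, h3⟩, hpq⟩
    have hne : p ≠ q := by
      rintro rfl
      exact hpq (SimpleGraph.Reachable.refl _)
    refine ⟨?_, ?_, ?_⟩
    · intro f hf
      rcases Finset.mem_insert.1 hf with rfl | hf
      · rwa [he, Sym2.mk_isDiag_iff]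
      · exact h1 f hf
    · rw [Finset.coe_insert, Set.injOn_insert (by simpa using heF)]
      refine ⟨h2, ?_⟩
      rintro ⟨f, hf, hfe⟩
      exact hpq (spanned_adj_of_mem hf (hfe.trans he) hne).reachable
    · rw [spanned_insert he]
      exact h3.sup_edge_of_not_reachable hpq

theorem IsRooted.eq {S : Set G.Vert} {F : Finset G.Edge} (h : G.IsRooted S F) {s t : G.Vert}
    (hs : s ∈ S) (ht : t ∈ S) (hst : (G.spanned F).Reachable s t) : s = t :=
  (h.2 t).unique ⟨hs, hst⟩ ⟨ht, SimpleGraph.Reachable.refl _⟩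

open scoped Classical in
/-- Joining the tree of an additional root `x` to the tree of a root `a` by an edge. -/
theorem isRooted_insert {e : G.Edge} {F : Finset G.Edge} (heF : e ∉ F) {p q x a : G.Vert}
    (he : G.ends e = s(p, q)) {S : Set G.Vert} (ha : a ∈ S) (hx : x ∉ S)
    (hp : (G.spanned F).Reachable p x) (hq : (G.spanned F).Reachable q a) :
    G.IsRooted (insert x S) F ↔ G.IsRooted S (insert e F) := by
  have hpq : (G.spanned F).Reachable p q ↔ (G.spanned F).Reachable a x :=
    ⟨fun h => hq.symm.trans (h.symm.trans hp), fun h => hp.trans (h.symm.trans hq.symm)⟩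
  -- Reachability after adding `e`, with its ends replaced by the vertices `x` and `a` of their
  -- trees.
  have key : ∀ s v, (G.spanned (insert e F)).Reachable s v ↔
      (G.spanned F).Reachable s v ∨
      ((G.spanned F).Reachable s x ∧ (G.spanned F).Reachable a v) ∨
      ((G.spanned F).Reachable s a ∧ (G.spanned F).Reachable x v) := by
    intro s v
    rw [spanned_insert he, SimpleGraph.reachable_sup_edge_iff]
    refine or_congr Iff.rfl (or_congr (and_congr ?_ ?_) (and_congr ?_ ?_))
    · exact ⟨fun h => h.trans hp, fun h => h.trans hp.symm⟩
    · exact ⟨fun h => hq.symm.trans h, fun h => hq.trans h⟩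
    · exact ⟨fun h => h.trans hq, fun h => h.trans hq.symm⟩
    · exact ⟨fun h => hp.symm.trans h, fun h => hp.trans h⟩
  have hxa : x ≠ a := fun h => hx (h ▸ ha)
  constructor
  · intro h
    have hax : ¬ (G.spanned F).Reachable a x := fun h' =>
      hxa (h.eq (Set.mem_insert_of_mem _ ha) (Set.mem_insert _ _) h').symm
    refine ⟨(isSpanningForest_insert heF he).2 ⟨h.1, fun h' => hax (hpq.1 h')⟩, fun v => ?_⟩
    have hS : ∀ s ∈ S, ¬ (G.spanned F).Reachable s x := fun s hs h' =>
      hx (h.eq (Set.mem_insert_of_mem _ hs) (Set.mem_insert _ _) h' ▸ hs)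
    obtain ⟨s, ⟨hs, hsv⟩, hu⟩ := h.2 v
    rcases hs with rfl | hs
    · refine ⟨a, ⟨ha, (key _ _).2 (Or.inr (Or.inr ⟨SimpleGraph.Reachable.refl _, hsv⟩))⟩, ?_⟩
      rintro s' ⟨hs', hsv'⟩
      rcases (key _ _).1 hsv' with h1 | ⟨h1, -⟩ | ⟨h1, -⟩
      · exact absurd (h1.trans hsv.symm) (hS _ hs')
      · exact absurd h1 (hS _ hs')
      · exact h.eq (Set.mem_insert_of_mem _ hs') (Set.mem_insert_of_mem _ ha) h1
    · refine ⟨s, ⟨hs, (key _ _).2 (Or.inl hsv)⟩, ?_⟩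
      rintro s' ⟨hs', hsv'⟩
      rcases (key _ _).1 hsv' with h1 | ⟨h1, -⟩ | ⟨-, h1⟩
      · exact hu s' ⟨Set.mem_insert_of_mem _ hs', h1⟩
      · exact absurd h1 (hS _ hs')
      · exact absurd (hsv.trans h1.symm) (hS _ hs)
  · intro h
    obtain ⟨hf, hpq'⟩ := (isSpanningForest_insert heF he).1 h.1
    have hax : ¬ (G.spanned F).Reachable a x := fun h' => hpq' (hpq.2 h')
    have hax' : (G.spanned (insert e F)).Reachable a x :=
      (key _ _).2 (Or.inr (Or.inr ⟨SimpleGraph.Reachable.refl _, SimpleGraph.Reachable.refl _⟩))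
    have hS : ∀ s ∈ S, ¬ (G.spanned F).Reachable s x := fun s hs h' =>
      hax (h.eq hs ha (((key _ _).2 (Or.inl h')).trans hax'.symm) ▸ h')
    refine ⟨hf, fun v => ?_⟩
    obtain ⟨s, ⟨hs, hsv⟩, hu⟩ := h.2 v
    rcases (key _ _).1 hsv with h1 | ⟨h1, -⟩ | ⟨-, h1⟩
    · refine ⟨s, ⟨Set.mem_insert_of_mem _ hs, h1⟩, ?_⟩
      rintro s' ⟨rfl | hs', hsv'⟩
      · exact absurd (h1.trans hsv'.symm) (hS _ hs)
      · exact hu _ ⟨hs', (key _ _).2 (Or.inl hsv')⟩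
    · exact absurd h1 (hS _ hs)
    · refine ⟨x, ⟨Set.mem_insert _ _, h1⟩, ?_⟩
      rintro s' ⟨rfl | hs', hsv'⟩
      · rfl
      · exact absurd (hsv'.trans h1.symm) (hS _ hs')

variable {R : Type*} [CommRing R] (w : G.Edge → R)

open scoped Classical in
/-- The weighted number of forests rooted at `S`. -/
noncomputable def rootedSum (S : Set G.Vert) : R :=
  ∑ F : Finset G.Edge with G.IsRooted S F, ∏ e ∈ F, w e

open scoped Classical in
/-- The weighted number of forests rooted at `S` in which `v` is in the tree of `a`. -/
noncomputable def hitSum (S : Set G.Vert) (a v : G.Vert) : R :=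
  ∑ F : Finset G.Edge with G.IsRooted S F ∧ (G.spanned F).Reachable a v, ∏ e ∈ F, w e

open scoped Classical in
/-- The total weight of the edges between `b` and `v`. -/
noncomputable def conductance (b v : G.Vert) : R :=
  ∑ e : G.Edge with G.ends e = s(b, v), w e

open scoped Classical in
-- Inserting `e` merges the tree of `x` into that of the root `a`, and the path from `x` to `a` then
-- crosses `e` from `p` to `q`. Erasing `e` is the inverse, and the weight changes by the factor `w
-- e`.
theorem weight_mul_sum_forest {e : G.Edge} {p q x a : G.Vert} (he : G.ends e = s(p, q))
    {S : Set G.Vert} (ha : a ∈ S) (hx : x ∉ S) :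
    w e * ∑ F : Finset G.Edge with G.IsRooted (insert x S) F ∧
        (G.spanned F).Reachable p x ∧ (G.spanned F).Reachable q a, ∏ f ∈ F, w f =
      ∑ F : Finset G.Edge with (G.IsRooted S F ∧ (G.spanned F).Reachable x a) ∧ e ∈ F ∧
        (G.spanned (F.erase e)).Reachable p x ∧ (G.spanned (F.erase e)).Reachable q a,
        ∏ f ∈ F, w f := by
  have hnot : ∀ F : Finset G.Edge, G.IsRooted (insert x S) F → (G.spanned F).Reachable p x →
      (G.spanned F).Reachable q a → e ∉ F := by
    intro F hF hp hq heF
    have hxa : x ≠ a := fun h => hx (h ▸ ha)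
    refine hxa (hF.eq (Set.mem_insert _ _) (Set.mem_insert_of_mem _ ha) (hp.symm.trans ?_))
    by_cases hpq : p = q
    · rwa [hpq]
    · exact (spanned_adj_of_mem heF he hpq).reachable.trans hq
  rw [Finset.mul_sum]
  refine Finset.sum_nbij' (fun F => insert e F) (fun F => F.erase e) ?_ ?_ ?_ ?_ ?_
  · intro F hF
    obtain ⟨hF, hp, hq⟩ := (Finset.mem_filter.1 hF).2
    have heF := hnot F hF hp hq
    have hF' := (isRooted_insert heF he ha hx hp hq).1 hF
    refine Finset.mem_filter.2 ⟨Finset.mem_univ _, ⟨hF', ?_⟩, Finset.mem_insert_self _ _, ?_⟩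
    · rw [spanned_insert he, SimpleGraph.reachable_sup_edge_iff]
      exact Or.inr (Or.inl ⟨hp.symm, hq⟩)
    · rw [Finset.erase_insert heF]
      exact ⟨hp, hq⟩
  · intro F hF
    obtain ⟨⟨hF, -⟩, heF, hp, hq⟩ := (Finset.mem_filter.1 hF).2
    refine Finset.mem_filter.2 ⟨Finset.mem_univ _, ?_, hp, hq⟩
    rw [isRooted_insert (Finset.notMem_erase e F) he ha hx hp hq, Finset.insert_erase heF]
    exact hF
  · intro F hF
    obtain ⟨hF, hp, hq⟩ := (Finset.mem_filter.1 hF).2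
    exact Finset.erase_insert (hnot F hF hp hq)
  · intro F hF
    exact Finset.insert_erase (Finset.mem_filter.1 hF).2.2.1
  · intro F hF
    obtain ⟨hF, hp, hq⟩ := (Finset.mem_filter.1 hF).2
    rw [Finset.prod_insert (hnot F hF hp hq)]

open scoped Classical in
-- The flow law for simple graphs carries over to multigraphs because a forest contains at most one
-- edge between `b` and `v`, and no loop.
theorem sum_flow {F : Finset G.Edge} (hF : G.IsSpanningForest F) {x a b : G.Vert}
    (hxa : (G.spanned F).Reachable x a) (hb : b ≠ a) :
    ∑ v, ∑ e : G.Edge with G.ends e = s(b, v),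
      ((if e ∈ F ∧ (G.spanned (F.erase e)).Reachable b x ∧ (G.spanned (F.erase e)).Reachable v a
          then (1 : R) else 0) -
        (if e ∈ F ∧ (G.spanned (F.erase e)).Reachable v x ∧ (G.spanned (F.erase e)).Reachable b a
          then 1 else 0)) = if b = x then 1 else 0 := by
  rw [← hF.2.2.sum_flow hxa hb]
  refine Finset.sum_congr rfl fun v _ => ?_
  by_cases h : (G.spanned F).Adj b v
  · rw [if_pos h]
    obtain ⟨⟨e, heF, he⟩, hbv⟩ := (SimpleGraph.fromEdgeSet_adj _).1 h
    rw [Finset.sum_eq_single e]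
    · have heF : e ∈ F := heF
      rw [spanned_erase heF hF.2.1, he]
      simp only [heF, true_and]
    · intro f hf hfe
      have : f ∉ F := fun hfF => hfe (hF.2.1 hfF heF ((Finset.mem_filter.1 hf).2.trans he.symm))
      simp only [this, false_and, if_false, sub_zero]
    · intro h'
      exact absurd (Finset.mem_filter.2 ⟨Finset.mem_univ e, he⟩) h'
  · rw [if_neg h]
    refine Finset.sum_eq_zero fun e he => ?_
    have he := (Finset.mem_filter.1 he).2
    have : e ∉ F := by
      intro heF
      refine h (spanned_adj_of_mem heF he ?_)
      have := hF.1 e heF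
      rwa [he, Sym2.mk_isDiag_iff] at this
    simp only [this, false_and, if_false, sub_zero]

open scoped Classical in
/-- Kirchhoff's law for rooted forests: `S` is the set of roots, one of which is `a`, and a unit
current enters at `x`. -/
theorem sum_conductance_mul_flow {S : Set G.Vert} {a x b : G.Vert} (ha : a ∈ S) (hx : x ∉ S)
    (hb : b ∉ S) :
    ∑ v, conductance w b v *
      (∑ F : Finset G.Edge with G.IsRooted (insert x S) F ∧
          (G.spanned F).Reachable b x ∧ (G.spanned F).Reachable v a, ∏ f ∈ F, w f -
        ∑ F : Finset G.Edge with G.IsRooted (insert x S) F ∧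
          (G.spanned F).Reachable v x ∧ (G.spanned F).Reachable b a, ∏ f ∈ F, w f) =
      if b = x then hitSum w S a x else 0 := by
  have hba : b ≠ a := fun h => hb (h ▸ ha)
  -- Both sums become sums over the same `S`-rooted forests, with sign given by the direction in
  -- which the path from `x` to `a` crosses `e`.
  calc _ = ∑ v, ∑ e : G.Edge with G.ends e = s(b, v),
        ∑ F : Finset G.Edge with G.IsRooted S F ∧ (G.spanned F).Reachable x a,
          (∏ f ∈ F, w f) *
          ((if e ∈ F ∧ (G.spanned (F.erase e)).Reachable b x ∧
              (G.spanned (F.erase e)).Reachable v a then (1 : R) else 0) -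
          (if e ∈ F ∧ (G.spanned (F.erase e)).Reachable v x ∧
              (G.spanned (F.erase e)).Reachable b a then 1 else 0)) := by
        refine Finset.sum_congr rfl fun v _ => ?_
        rw [conductance, Finset.sum_mul]
        refine Finset.sum_congr rfl fun e he => ?_
        have he := (Finset.mem_filter.1 he).2
        rw [mul_sub, weight_mul_sum_forest w he ha hx,
          weight_mul_sum_forest w (he.trans Sym2.eq_swap) ha hx]
        simp only [mul_sub, mul_ite, mul_one, mul_zero, Finset.sum_sub_distrib,
          ← Finset.sum_filter, Finset.filter_filter]
    _ = _ := by
        have : ∀ v, ∑ e : G.Edge with G.ends e = s(b, v),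
            ∑ F : Finset G.Edge with G.IsRooted S F ∧ (G.spanned F).Reachable x a,
              (∏ f ∈ F, w f) *
              ((if e ∈ F ∧ (G.spanned (F.erase e)).Reachable b x ∧
                  (G.spanned (F.erase e)).Reachable v a then (1 : R) else 0) -
              (if e ∈ F ∧ (G.spanned (F.erase e)).Reachable v x ∧
                  (G.spanned (F.erase e)).Reachable b a then 1 else 0)) = _ :=
          fun v => Finset.sum_comm
        -- With the forest fixed, the inner sum is the net flow out of `b`.
        rw [Finset.sum_congr rfl fun v _ => this v, Finset.sum_comm]
        simp only [← Finset.mul_sum]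
        have h2 : ∀ F ∈ Finset.univ.filter fun F : Finset G.Edge =>
            G.IsRooted S F ∧ (G.spanned F).Reachable x a, _ = _ := fun F hF =>
          congrArg (fun t : R => (∏ f ∈ F, w f) * t)
            (sum_flow (R := R) (Finset.mem_filter.1 hF).2.1.1 (Finset.mem_filter.1 hF).2.2 hba)
        rw [Finset.sum_congr rfl h2]
        split_ifs
        · simp only [mul_one, hitSum, SimpleGraph.reachable_comm (u := a)]
        · simp

theorem conductance_comm (b v : G.Vert) : conductance w b v = conductance w v b := by
  rw [conductance, conductance, Sym2.eq_swap]

theorem hitSum_of_ne {S : Set G.Vert} {a v : G.Vert} (ha : a ∈ S) (hv : v ∈ S) (h : a ≠ v) :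
    hitSum w S a v = 0 := by
  classical
  rw [hitSum, Finset.filter_false_of_mem, Finset.sum_empty]
  rintro F - ⟨hF, hav⟩
  exact h (hF.eq ha hv hav)

open scoped Classical in
theorem IsRooted.sum_reachable {S : Set G.Vert} {F : Finset G.Edge} (hF : G.IsRooted S F)
    (v : G.Vert) : ∑ a with a ∈ S, (if (G.spanned F).Reachable v a then (1 : R) else 0) = 1 := by
  obtain ⟨s, ⟨hs, hsv⟩, hu⟩ := hF.2 v
  rw [Finset.sum_eq_single s]
  · rw [if_pos hsv.symm]
  · intro t ht hts
    exact if_neg fun h => hts (hu t ⟨(Finset.mem_filter.1 ht).2, h.symm⟩)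
  · intro h
    exact absurd (Finset.mem_filter.2 ⟨Finset.mem_univ s, hs⟩) h

open scoped Classical in
theorem hitSum_eq (S : Set G.Vert) (a v : G.Vert) : hitSum w S a v =
    ∑ F : Finset G.Edge with G.IsRooted S F,
      (∏ e ∈ F, w e) * if (G.spanned F).Reachable v a then 1 else 0 := by
  simp only [hitSum, mul_ite, mul_one, mul_zero, ← Finset.sum_filter, Finset.filter_filter,
    SimpleGraph.reachable_comm (u := a)]

theorem hitSum_root (S : Set G.Vert) (a : G.Vert) : hitSum w S a a = rootedSum w S := by
  rw [hitSum_eq, rootedSum]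
  refine Finset.sum_congr rfl fun F _ => ?_
  rw [if_pos (SimpleGraph.Reachable.refl _), mul_one]

open scoped Classical in
theorem sum_hitSum (S : Set G.Vert) (v : G.Vert) :
    ∑ a with a ∈ S, hitSum w S a v = rootedSum w S := by
  simp only [hitSum_eq]
  rw [Finset.sum_comm, rootedSum]
  refine Finset.sum_congr rfl fun F hF => ?_
  rw [← Finset.mul_sum, (Finset.mem_filter.1 hF).2.sum_reachable, mul_one]

/-- The first edge of the path from `b` to a root `a`. -/
theorem sum_conductance_mul_hitSum {S : Set G.Vert} {a b : G.Vert} (ha : a ∈ S) (hb : b ∉ S) :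
    ∑ v, conductance w b v * hitSum w (insert b S) a v = hitSum w S a b := by
  classical
  have := sum_conductance_mul_flow w ha hb hb
  rw [if_pos rfl] at this
  rw [← this]
  refine Finset.sum_congr rfl fun v _ => ?_
  congr 1
  -- For `x = b` there is no reverse term: `b` is itself a root and cannot lie in the tree of `a`.
  rw [hitSum, Finset.filter_false_of_mem (p := fun F => G.IsRooted (insert b S) F ∧
    (G.spanned F).Reachable v b ∧ (G.spanned F).Reachable b a), Finset.sum_empty, sub_zero]
  · simp only [SimpleGraph.Reachable.refl, true_and, SimpleGraph.reachable_comm (u := a)]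
  · rintro F - ⟨hF, -, hba⟩
    exact hb (hF.eq (Set.mem_insert _ _) (Set.mem_insert_of_mem _ ha) hba ▸ ha)

open scoped Classical in
/-- `hitSum w (insert x S) x` is a Green function for the Laplacian with boundary `S`. -/
theorem laplacian_hitSum {S : Set G.Vert} {x b : G.Vert} (hx : x ∉ S) (hb : b ∉ S) :
    ∑ v, conductance w b v * (hitSum w (insert x S) x b - hitSum w (insert x S) x v) =
      if b = x then rootedSum w S else 0 := by
  rw [← sum_hitSum w S x]
  have h1 : (if b = x then ∑ a with a ∈ S, hitSum w S a x else 0) =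
      ∑ a with a ∈ S, if b = x then hitSum w S a x else 0 := by
    split_ifs <;> simp
  rw [h1, Finset.sum_congr rfl fun a ha =>
    (sum_conductance_mul_flow w (Finset.mem_filter.1 ha).2 hx hb).symm, Finset.sum_comm]
  refine Finset.sum_congr rfl fun v _ => ?_
  rw [← Finset.mul_sum]
  congr 1
  have hs : ∀ p q a : G.Vert, ∑ F : Finset G.Edge with G.IsRooted (insert x S) F ∧
      (G.spanned F).Reachable p x ∧ (G.spanned F).Reachable q a, ∏ f ∈ F, w f =
      ∑ F : Finset G.Edge with G.IsRooted (insert x S) F,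
        ((∏ f ∈ F, w f) * if (G.spanned F).Reachable p x then 1 else 0) *
          if (G.spanned F).Reachable q a then 1 else 0 := by
    intro p q a
    simp only [mul_ite, mul_one, mul_zero, ← Finset.sum_filter, Finset.filter_filter, and_assoc,
      and_comm (a := (G.spanned _).Reachable q a)]
  simp only [hs, hitSum_eq, Finset.sum_sub_distrib]
  rw [Finset.sum_comm, Finset.sum_comm (s := Finset.univ.filter fun a => a ∈ S),
    ← Finset.sum_sub_distrib, ← Finset.sum_sub_distrib]
  refine Finset.sum_congr rfl fun F hF => ?_
  simp only [← Finset.mul_sum]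
  -- Lying in the tree of some root in `S` is the complement of lying in the tree of `x`. With `[q]`
  -- the indicator of the latter, `[b](1 - [v]) - [v](1 - [b]) = [b] - [v]`.
  have hr : ∀ q, ∑ a with a ∈ S, (if (G.spanned F).Reachable q a then (1 : R) else 0) =
      1 - if (G.spanned F).Reachable q x then 1 else 0 := by
    intro q
    have := (Finset.mem_filter.1 hF).2.sum_reachable (R := R) q
    have hfil : @Finset.filter _ (fun a => a ∈ insert x S) (fun _ => Classical.propDecidable _)
        Finset.univ = insert x (Finset.univ.filter fun a => a ∈ S) := by
      ext a
      simp
    rw [hfil, Finset.sum_insert (by simpa using hx)] at this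
    exact eq_sub_of_add_eq' this
  rw [hr, hr]
  ring

end MarkedGraph

/-! ### The Laplacian, harmonic extension and the contraction identity. -/

namespace MarkedGraph

variable {m : ℕ} {G : MarkedGraph m} {R : Type*} [CommRing R] (w : G.Edge → R)

/-- The Laplacian is self-adjoint. -/
theorem laplacian_self_adjoint (f g : G.Vert → R) :
    ∑ b, f b * ∑ v, conductance w b v * (g b - g v) =
      ∑ b, (∑ v, conductance w b v * (f b - f v)) * g b := by
  simp only [Finset.mul_sum, Finset.sum_mul]
  have h : ∑ b, ∑ v, conductance w b v * f b * g v = ∑ b, ∑ v, conductance w b v * f v * g b := by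
    rw [Finset.sum_comm]
    simp only [conductance_comm w]
  rw [← sub_eq_zero, ← Finset.sum_sub_distrib]
  simp only [← Finset.sum_sub_distrib]
  rw [← sub_eq_zero] at h
  rw [← neg_eq_zero, ← h, ← Finset.sum_neg_distrib, ← Finset.sum_sub_distrib]
  refine Finset.sum_congr rfl fun b _ => ?_
  rw [← Finset.sum_neg_distrib, ← Finset.sum_sub_distrib]
  refine Finset.sum_congr rfl fun v _ => ?_
  ring

/-- The probability of reaching the root `a` first is harmonic. -/
theorem laplacian_hitSum_eq_zero {S : Set G.Vert} {a b : G.Vert} (ha : a ∈ S) (hb : b ∉ S) :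
    ∑ v, conductance w b v * (hitSum w S a b - hitSum w S a v) = 0 := by
  have h := laplacian_hitSum w (S := S \ {a}) (x := a) (b := b) (by simp) (fun h => hb h.1)
  rw [Set.insert_sdiff_singleton, Set.insert_eq_of_mem ha, if_neg] at h
  · exact h
  · rintro rfl
    exact hb ha

open scoped Classical in
/-- A function harmonic off `S` is determined by its values on `S`. -/
theorem rootedSum_mul_eq_sum_hitSum {S : Set G.Vert} (f : G.Vert → R)
    (hf : ∀ b ∉ S, ∑ v, conductance w b v * (f b - f v) = 0)
    (hT : rootedSum w S ∈ nonZeroDivisors R) (v : G.Vert) :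
    rootedSum w S * f v = ∑ a with a ∈ S, hitSum w S a v * f a := by
  by_cases hv : v ∈ S
  · rw [Finset.sum_eq_single v]
    · rw [hitSum_root]
    · intro a ha hav
      rw [hitSum_of_ne w (Finset.mem_filter.1 ha).2 hv hav, zero_mul]
    · intro h
      exact absurd (Finset.mem_filter.2 ⟨Finset.mem_univ v, hv⟩) h
  -- The defect `g` vanishes on `S` and is harmonic off `S`. Pairing it with the Green function at
  -- `v` replaces a maximum principle and gives `g v * rootedSum w S = 0`.
  set g : G.Vert → R := fun u => rootedSum w S * f u - ∑ a with a ∈ S, hitSum w S a u * f a with hg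
  have hgS : ∀ u ∈ S, g u = 0 := by
    intro u hu
    simp only [hg]
    rw [Finset.sum_eq_single u, hitSum_root, sub_self]
    · intro a ha hau
      rw [hitSum_of_ne w (Finset.mem_filter.1 ha).2 hu hau, zero_mul]
    · intro h
      exact absurd (Finset.mem_filter.2 ⟨Finset.mem_univ u, hu⟩) h
  have hgL : ∀ b ∉ S, ∑ u, conductance w b u * (g b - g u) = 0 := by
    intro b hb
    have h1 : ∀ u, conductance w b u * (g b - g u) =
        rootedSum w S * (conductance w b u * (f b - f u)) -
          ∑ a with a ∈ S, f a * (conductance w b u * (hitSum w S a b - hitSum w S a u)) := by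
      intro u
      have : ∑ a with a ∈ S, f a * (conductance w b u * (hitSum w S a b - hitSum w S a u)) =
          conductance w b u * (∑ a with a ∈ S, hitSum w S a b * f a -
            ∑ a with a ∈ S, hitSum w S a u * f a) := by
        rw [← Finset.sum_sub_distrib, Finset.mul_sum]
        refine Finset.sum_congr rfl fun a _ => ?_
        ring
      rw [this]
      simp only [hg]
      ring
    simp only [h1, Finset.sum_sub_distrib]
    rw [← Finset.mul_sum, hf b hb, mul_zero, zero_sub, neg_eq_zero, Finset.sum_comm]
    refine Finset.sum_eq_zero fun a ha => ?_
    rw [← Finset.mul_sum, laplacian_hitSum_eq_zero w (Finset.mem_filter.1 ha).2 hb, mul_zero]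
  have h := laplacian_self_adjoint w g (hitSum w (insert v S) v)
  have hl : ∑ b, g b * ∑ u, conductance w b u *
      (hitSum w (insert v S) v b - hitSum w (insert v S) v u) = g v * rootedSum w S := by
    rw [Finset.sum_eq_single v]
    · rw [laplacian_hitSum w hv hv, if_pos rfl]
    · intro b _ hbv
      by_cases hb : b ∈ S
      · rw [hgS b hb, zero_mul]
      · rw [laplacian_hitSum w hv hb, if_neg hbv, mul_zero]
    · simp
  have hr : ∑ b, (∑ u, conductance w b u * (g b - g u)) * hitSum w (insert v S) v b = 0 := by
    refine Finset.sum_eq_zero fun b _ => ?_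
    by_cases hb : b ∈ S
    · rw [hitSum_of_ne w (Set.mem_insert _ _) (Set.mem_insert_of_mem _ hb), mul_zero]
      rintro rfl
      exact hv hb
    · rw [hgL b hb, zero_mul]
  rw [hl, hr] at h
  exact sub_eq_zero.1 ((mul_right_mem_nonZeroDivisors_eq_zero_iff hT).1 h)

/-- The right-hand side does not mention `s`, so the spanning tree sum `rootedSum w {s}` is the same
for every root. -/
theorem isRooted_singleton {F : Finset G.Edge} {s : G.Vert} :
    G.IsRooted {s} F ↔ G.IsSpanningForest F ∧ (G.spanned F).Connected := by
  refine and_congr Iff.rfl ⟨fun h => ?_, fun h v => ⟨s, ⟨rfl, h.preconnected s v⟩, by simp⟩⟩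
  have hs : ∀ v, (G.spanned F).Reachable s v := fun v => by
    obtain ⟨t, ⟨rfl, ht⟩, -⟩ := h v
    exact ht
  have : Nonempty G.Vert := ⟨s⟩
  exact SimpleGraph.Connected.mk fun u v => (hs u).symm.trans (hs v)

open scoped Classical in
/-- Contracting the response matrix with a potential: for distinct roots `b`, `c`, the sum of
`(forests rooted at S with a, b joined) * (forests with two trees separating b from a, c)` does
not depend on `b` and `c`. -/
theorem sum_hitSum_mul_hitSum {S : Set G.Vert} {b c : G.Vert} (hb : b ∈ S) (hc : c ∈ S)
    (hbc : b ≠ c) (hT : rootedSum w S ∈ nonZeroDivisors R) :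
    ∑ a with a ∈ S \ {b}, hitSum w (S \ {b}) a b * hitSum w {b, c} c a =
      rootedSum w S * rootedSum w {c} := by
  have hS : insert b (S \ {b}) = S := by
    rw [Set.insert_sdiff_singleton, Set.insert_eq_of_mem hb]
  have h1 : ∀ a ∈ S \ {b}, hitSum w (S \ {b}) a b =
      ∑ v, conductance w b v * hitSum w S a v := by
    intro a ha
    rw [← sum_conductance_mul_hitSum w ha (by simp), hS]
  have hf : ∀ v ∉ S, ∑ u, conductance w v u * (hitSum w {b, c} c v - hitSum w {b, c} c u) = 0 := by
    intro v hv
    refine laplacian_hitSum_eq_zero w (by simp) ?_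
    rintro (rfl | rfl)
    · exact hv hb
    · exact hv hc
  have h2 := rootedSum_mul_eq_sum_hitSum w (hitSum w {b, c} c) hf hT
  -- The root `b` may be left out of the harmonic extension because the potential vanishes there.
  have h3 : ∀ v, ∑ a with a ∈ S \ {b}, hitSum w S a v * hitSum w {b, c} c a =
      rootedSum w S * hitSum w {b, c} c v := by
    intro v
    rw [h2]
    refine Finset.sum_subset (fun a ha => ?_) fun a ha hab => ?_
    · simp only [Finset.mem_filter] at ha ⊢
      exact ⟨ha.1, ha.2.1⟩
    · simp only [Finset.mem_filter, Finset.mem_univ, true_and, Set.mem_sdiff,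
        Set.mem_singleton_iff, not_and, not_not] at ha hab
      rw [hab ha, hitSum_of_ne w (S := {b, c}) (by simp) (by simp) hbc.symm, mul_zero]
  calc _ = ∑ a with a ∈ S \ {b}, ∑ v,
        conductance w b v * (hitSum w S a v * hitSum w {b, c} c a) := by
        refine Finset.sum_congr rfl fun a ha => ?_
        rw [h1 a (Finset.mem_filter.1 ha).2, Finset.sum_mul]
        exact Finset.sum_congr rfl fun v _ => mul_assoc _ _ _
    _ = ∑ v, rootedSum w S * (conductance w b v * hitSum w {b, c} c v) := by
        rw [Finset.sum_comm]
        refine Finset.sum_congr rfl fun v _ => ?_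
        rw [← Finset.mul_sum, h3]
        ring
    _ = _ := by
        -- The first-edge formula again, now with the single root `c`: the current at `b` counts all
        -- spanning trees.
        rw [← Finset.mul_sum, sum_conductance_mul_hitSum w (S := {c}) rfl (by simpa using hbc),
          ← hitSum_root w {c} c]
        congr 1
        simp only [hitSum_eq]
        refine Finset.sum_congr rfl fun F hF => ?_
        have := (isRooted_singleton.1 (Finset.mem_filter.1 hF).2).2
        rw [if_pos (this.preconnected _ _), if_pos (this.preconnected _ _)]

end MarkedGraph

/-! ### Set partitions into `m - 1` and into 2 parts. -/

theorem card_quotient_eq_pred_iff {m : ℕ} {P : Setoid (Fin m)} {a b : Fin m} (hab : a ≠ b)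
    (h : P a b) : Nat.card (Quotient P) = m - 1 ↔ ∀ i j, i ≠ b → j ≠ b → P i j → i = j := by
  -- As `a` represents the class of `b`, the `m - 1` elements other than `b` meet every class; the
  -- count says that they do so injectively.
  let f : {i : Fin m // i ≠ b} → Quotient P := fun i => Quotient.mk P i.1
  have hf : Function.Surjective f := by
    intro q
    induction q using Quotient.inductionOn with
    | h x =>
      by_cases hx : x = b
      · exact ⟨⟨a, hab⟩, Quotient.sound (hx ▸ h)⟩
      · exact ⟨⟨x, hx⟩, rfl⟩
  have hcard : Nat.card {i : Fin m // i ≠ b} = m - 1 := by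
    simp [Nat.card_eq_fintype_card, Fintype.card_subtype_compl]
  constructor
  · intro hP i j hi hj hij
    have hb : Function.Bijective f :=
      (Nat.bijective_iff_surjective_and_card f).2 ⟨hf, hcard.trans hP.symm⟩
    exact congrArg Subtype.val (hb.1 (a₁ := ⟨i, hi⟩) (a₂ := ⟨j, hj⟩) (Quotient.sound hij))
  · intro hP
    rw [← hcard]
    refine (Nat.card_eq_of_bijective f ⟨fun i j hij => Subtype.ext ?_, hf⟩).symm
    exact hP _ _ i.2 j.2 (Quotient.exact hij)

theorem card_quotient_eq_two_iff {m : ℕ} {P : Setoid (Fin m)} {b c : Fin m} (h : ¬ P b c) :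
    Nat.card (Quotient P) = 2 ↔ ∀ i, P b i ∨ P c i := by
  let f : Bool → Quotient P := fun t => cond t (Quotient.mk P b) (Quotient.mk P c)
  have hf : Function.Injective f := by
    rintro (_ | _) (_ | _) hst
    · rfl
    · exact absurd (Setoid.symm' P (Quotient.exact hst)) h
    · exact absurd (Quotient.exact hst) h
    · rfl
  constructor
  · intro hP i
    have hb : Function.Bijective f :=
      (Nat.bijective_iff_injective_and_card f).2 ⟨hf, by rw [hP]; simp⟩
    obtain ⟨(_ | _), ht⟩ := hb.2 (Quotient.mk P i)
    · exact Or.inr (Quotient.exact ht)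
    · exact Or.inl (Quotient.exact ht)
  · intro hP
    have hb : Function.Bijective f := by
      refine ⟨hf, fun q => ?_⟩
      induction q using Quotient.inductionOn with
      | h x =>
        rcases hP x with hx | hx
        · exact ⟨true, Quotient.sound hx⟩
        · exact ⟨false, Quotient.sound hx⟩
    rw [← Nat.card_eq_of_bijective f hb]
    simp

/-! ### Forest polynomials as weighted sums over rooted forests. -/

namespace MarkedGraph

variable {m : ℕ} (G : MarkedGraph m)

/-- The set partition of the marked vertices given by the trees of `F`. -/
def markPartition (F : Finset G.Edge) : Setoid (Fin m) :=
  (G.spanned F).reachableSetoid.comap G.mark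

variable {G}

theorem markPartition_apply {F : Finset G.Edge} {i j : Fin m} :
    G.markPartition F i j ↔ (G.spanned F).Reachable (G.mark i) (G.mark j) := Iff.rfl

/-- The bijection is forced by the marks, so a forest is compatible with at most one partition, the
one it induces; surjectivity means that no tree is unmarked. -/
theorem compatible_iff {F : Finset G.Edge} {P : Setoid (Fin m)} :
    G.Compatible F P ↔
      G.markPartition F = P ∧ ∀ v, ∃ i, (G.spanned F).Reachable (G.mark i) v := by
  constructor
  · rintro ⟨φ, hφ⟩
    refine ⟨Setoid.ext fun i j => ?_, fun v => ?_⟩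
    · rw [markPartition_apply, ← SimpleGraph.ConnectedComponent.eq, ← φ.injective.eq_iff, hφ, hφ]
      exact Quotient.eq
    · obtain ⟨i, hi⟩ := Quotient.exists_rep (φ ((G.spanned F).connectedComponentMk v))
      refine ⟨i, SimpleGraph.ConnectedComponent.eq.1 (φ.injective ?_)⟩
      rw [hφ, ← hi]
  · rintro ⟨rfl, hv⟩
    let f : Quotient (G.markPartition F) → (G.spanned F).ConnectedComponent :=
      Quotient.lift (fun i => (G.spanned F).connectedComponentMk (G.mark i))
        fun i j hij => SimpleGraph.ConnectedComponent.eq.2 hij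
    have hf : Function.Bijective f := by
      constructor
      · intro p q
        induction p, q using Quotient.inductionOn₂ with
        | h i j => exact fun h => Quotient.sound (SimpleGraph.ConnectedComponent.eq.1 h)
      · intro C
        induction C using SimpleGraph.ConnectedComponent.ind with
        | h v =>
          obtain ⟨i, hi⟩ := hv v
          exact ⟨Quotient.mk _ i, SimpleGraph.ConnectedComponent.eq.2 hi⟩
    refine ⟨(Equiv.ofBijective f hf).symm, fun i => ?_⟩
    rw [Equiv.symm_apply_eq]
    rfl

variable (K : Type*) [Field K]

open scoped Classical in
/-- A sum of spanning forest polynomials over a set of partitions into `k` parts. -/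
theorem sum_forestPoly (k : ℕ) [Fintype (PartitionsInto m k)] (c : Setoid (Fin m) → Prop)
    [DecidablePred c] :
    ∑ P : PartitionsInto m k with c P.1, G.forestPoly K P.1 =
      ∑ F : Finset G.Edge with G.IsSpanningForest F ∧
        (∀ v, ∃ i, (G.spanned F).Reachable (G.mark i) v) ∧
        Nat.card (Quotient (G.markPartition F)) = k ∧ c (G.markPartition F),
        ∏ e ∈ Fᶜ, MvPolynomial.X e := by
  simp only [forestPoly, Finset.sum_filter]
  simp only [← Finset.sum_filter (fun P : PartitionsInto m k => c P.1)]
  rw [Finset.sum_comm]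
  refine Finset.sum_congr rfl fun F _ => ?_
  by_cases hk : Nat.card (Quotient (G.markPartition F)) = k
  · rw [Finset.sum_filter, Finset.sum_eq_single ⟨G.markPartition F, hk⟩]
    · rw [← ite_and]
      refine if_congr ?_ rfl rfl
      simp only [compatible_iff, hk, true_and]
      tauto
    · intro P _ hP
      rw [if_neg (c := G.IsSpanningForest F ∧ G.Compatible F P.1), ite_self]
      rintro ⟨-, h⟩
      exact hP (Subtype.ext (compatible_iff.1 h).1.symm)
    · simp
  · rw [if_neg fun h => hk h.2.2.1]
    refine Finset.sum_eq_zero fun P _ => if_neg ?_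
    rintro ⟨-, h⟩
    exact hk ((compatible_iff.1 h).1 ▸ P.2)

/-- Only `a` and `b` share a tree, so the marks other than `b` serve as roots. -/
theorem forest_pred_iff {F : Finset G.Edge} {a b : Fin m} (hab : a ≠ b) :
    (G.IsSpanningForest F ∧ (∀ v, ∃ i, (G.spanned F).Reachable (G.mark i) v) ∧
      Nat.card (Quotient (G.markPartition F)) = m - 1 ∧ G.markPartition F a b) ↔
    G.IsRooted (Set.range G.mark \ {G.mark b}) F ∧
      (G.spanned F).Reachable (G.mark a) (G.mark b) := by
  rw [IsRooted, and_assoc]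
  refine and_congr Iff.rfl ?_
  rw [← and_assoc]
  refine and_congr_left fun h => ?_
  have h : (G.spanned F).Reachable (G.mark a) (G.mark b) := h
  rw [card_quotient_eq_pred_iff hab h]
  constructor
  · rintro ⟨hv, hu⟩ v
    have : ∃ i ≠ b, (G.spanned F).Reachable (G.mark i) v := by
      obtain ⟨i, hi⟩ := hv v
      by_cases hib : i = b
      · exact ⟨a, hab, h.trans (hib ▸ hi)⟩
      · exact ⟨i, hib, hi⟩
    obtain ⟨i, hib, hi⟩ := this
    refine ⟨G.mark i, ⟨⟨⟨i, rfl⟩, fun h => hib (G.mark.injective h)⟩, hi⟩, ?_⟩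
    rintro _ ⟨⟨⟨j, rfl⟩, hjb⟩, hj⟩
    rw [hu j i (fun h => hjb (congrArg G.mark h)) hib (hj.trans hi.symm)]
  · intro hr
    constructor
    · intro v
      obtain ⟨_, ⟨⟨⟨i, rfl⟩, -⟩, hi⟩, -⟩ := hr v
      exact ⟨i, hi⟩
    · intro i j hi hj hij
      exact G.mark.injective ((hr (G.mark j)).unique
        ⟨⟨⟨i, rfl⟩, fun h => hi (G.mark.injective h)⟩, hij⟩
        ⟨⟨⟨j, rfl⟩, fun h => hj (G.mark.injective h)⟩, SimpleGraph.Reachable.refl _⟩)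

/-- With `b` and `c` as the roots of the two trees, being separated from `b` means lying in the tree
of `c`. -/
theorem forest_two_iff {F : Finset G.Edge} {a b c : Fin m} (hbc : b ≠ c) :
    (G.IsSpanningForest F ∧ (∀ v, ∃ i, (G.spanned F).Reachable (G.mark i) v) ∧
      Nat.card (Quotient (G.markPartition F)) = 2 ∧
      (¬ G.markPartition F a b ∧ ¬ G.markPartition F b c)) ↔
    G.IsRooted {G.mark b, G.mark c} F ∧ (G.spanned F).Reachable (G.mark c) (G.mark a) := by
  constructor
  · rintro ⟨hF, hv, hcard, hab, hb⟩
    rw [card_quotient_eq_two_iff hb] at hcard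
    refine ⟨⟨hF, fun v => ?_⟩, (hcard a).resolve_left fun h => hab (Setoid.symm' _ h)⟩
    obtain ⟨i, hi⟩ := hv v
    rcases hcard i with h | h
    · refine ⟨G.mark b, ⟨by simp, SimpleGraph.Reachable.trans h hi⟩, ?_⟩
      rintro _ ⟨rfl | rfl, hj⟩
      · rfl
      · exact absurd (SimpleGraph.Reachable.trans h (hi.trans hj.symm)) hb
    · refine ⟨G.mark c, ⟨by simp, SimpleGraph.Reachable.trans h hi⟩, ?_⟩
      rintro _ ⟨rfl | rfl, hj⟩
      · exact absurd (hj.trans (SimpleGraph.Reachable.trans h hi).symm) hb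
      · rfl
  · rintro ⟨hF, hca⟩
    have hb : ¬ G.markPartition F b c := fun h =>
      hbc (G.mark.injective (hF.eq (by simp) (by simp) h))
    refine ⟨hF.1, fun v => ?_, (card_quotient_eq_two_iff hb).2 fun i => ?_,
      fun h => hb ?_, hb⟩
    · obtain ⟨_, ⟨rfl | rfl, hi⟩, -⟩ := hF.2 v
      exacts [⟨_, hi⟩, ⟨_, hi⟩]
    · obtain ⟨_, ⟨rfl | rfl, hi⟩, -⟩ := hF.2 (G.mark i)
      exacts [Or.inl hi, Or.inr hi]
    · exact (hca.trans h).symm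

/-- The field in which the spanning forest polynomials are evaluated. -/
abbrev RatFun (G : MarkedGraph m) : Type _ := FractionRing (MvPolynomial G.Edge K)

/-- The weight `1 / a_e` of the edge `e`. -/
noncomputable def weight (e : G.Edge) : RatFun K G :=
  (algebraMap (MvPolynomial G.Edge K) (RatFun K G) (MvPolynomial.X e))⁻¹

/-- The product of all edge variables. -/
noncomputable def edgeProd (G : MarkedGraph m) : RatFun K G :=
  algebraMap (MvPolynomial G.Edge K) (RatFun K G) (∏ e, MvPolynomial.X e)

theorem algebraMap_prod_compl [DecidableEq G.Edge] (F : Finset G.Edge) :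
    algebraMap (MvPolynomial G.Edge K) (RatFun K G) (∏ e ∈ Fᶜ, MvPolynomial.X e) =
      edgeProd K G * ∏ e ∈ F, weight K e := by
  rw [edgeProd, ← Finset.prod_compl_mul_prod F, map_mul, mul_assoc]
  simp only [weight, Finset.prod_inv_distrib, map_prod]
  rw [mul_inv_cancel₀, mul_one]
  refine Finset.prod_ne_zero_iff.2 fun e _ => ?_
  simp [MvPolynomial.X_ne_zero]

open scoped Classical in
-- Different forests give different squarefree monomials with coefficient 1, so nothing cancels in
-- any characteristic.
theorem sum_prod_compl_eq_zero {s : Finset (Finset G.Edge)}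
    (h : ∑ F ∈ s, ∏ e ∈ Fᶜ, (MvPolynomial.X e : MvPolynomial G.Edge K) = 0) : s = ∅ := by
  by_contra hs
  obtain ⟨F, hF⟩ := Finset.nonempty_iff_ne_empty.2 hs
  have hmon : ∀ t : Finset G.Edge, ∏ e ∈ t, (MvPolynomial.X e : MvPolynomial G.Edge K) =
      MvPolynomial.monomial (∑ e ∈ t, Finsupp.single e 1) 1 := by
    intro t
    simp [MvPolynomial.X, MvPolynomial.monomial_sum_one]
  have hinj : ∀ t t' : Finset G.Edge, ∑ e ∈ t, Finsupp.single e 1 = ∑ e ∈ t', Finsupp.single e 1 →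
      t = t' := by
    intro t t' htt
    ext e
    have := DFunLike.congr_fun htt e
    simp only [Finsupp.finsetSum_apply, Finsupp.single_apply, Finset.sum_ite_eq'] at this
    split_ifs at this with h1 h2 <;> simp_all
  have := congrArg (MvPolynomial.coeff (∑ e ∈ Fᶜ, Finsupp.single e 1)) h
  rw [MvPolynomial.coeff_sum, Finset.sum_eq_single F] at this
  · rw [hmon, MvPolynomial.coeff_monomial, if_pos rfl] at this
    simp at this
  · intro F' _ hne
    rw [hmon, MvPolynomial.coeff_monomial, if_neg]
    exact fun h => hne (compl_injective (hinj _ _ h))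
  · exact fun h => absurd hF h

theorem rootedSum_weight_eq_zero {S : Set G.Vert} (h : rootedSum (weight K) S = 0)
    (F : Finset G.Edge) : ¬ G.IsRooted S F := by
  classical
  intro hF
  have := congrArg (fun t => edgeProd K G * t) h
  simp only [rootedSum, mul_zero, Finset.mul_sum, ← algebraMap_prod_compl] at this
  rw [← map_sum, map_eq_zero_iff _ (IsFractionRing.injective _ _)] at this
  have := sum_prod_compl_eq_zero K this
  exact Finset.notMem_empty F (this ▸ Finset.mem_filter.2 ⟨Finset.mem_univ F, hF⟩)

open scoped Classical in
theorem algebraMap_sum_forestPoly_pred [Fintype (PartitionsInto m (m - 1))] {a b : Fin m}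
    (hab : a ≠ b) :
    algebraMap (MvPolynomial G.Edge K) (RatFun K G)
      (∑ P : PartitionsInto m (m - 1) with P.1 a b, G.forestPoly K P.1) =
      edgeProd K G *
        hitSum (weight K) (Set.range G.mark \ {G.mark b}) (G.mark a) (G.mark b) := by
  rw [sum_forestPoly K (m - 1) (fun P => P a b), map_sum, hitSum, Finset.mul_sum]
  simp only [forest_pred_iff hab, algebraMap_prod_compl]

open scoped Classical in
theorem algebraMap_sum_forestPoly_two [Fintype (PartitionsInto m 2)] {a b c : Fin m}
    (hbc : b ≠ c) :
    algebraMap (MvPolynomial G.Edge K) (RatFun K G)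
      (∑ P : PartitionsInto m 2 with ¬ P.1 a b ∧ ¬ P.1 b c, G.forestPoly K P.1) =
      edgeProd K G * hitSum (weight K) {G.mark b, G.mark c} (G.mark c) (G.mark a) := by
  rw [sum_forestPoly K 2 (fun P => ¬ P a b ∧ ¬ P b c), map_sum, hitSum, Finset.mul_sum]
  simp only [forest_two_iff hbc, algebraMap_prod_compl]

open scoped Classical in
/-- The column expansion identity: the left-hand side does not depend on `b` and `c`. -/
theorem sum_forestPoly_mul_sum_forestPoly [Fintype (PartitionsInto m (m - 1))]
    [Fintype (PartitionsInto m 2)] {b c b' c' : Fin m} (hbc : b ≠ c) (hbc' : b' ≠ c') :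
    ∑ a with a ≠ b, (∑ A : PartitionsInto m (m - 1) with A.1 a b, G.forestPoly K A.1) *
        ∑ B : PartitionsInto m 2 with ¬ B.1 a b ∧ ¬ B.1 b c, G.forestPoly K B.1 =
      ∑ a with a ≠ b', (∑ A : PartitionsInto m (m - 1) with A.1 a b', G.forestPoly K A.1) *
        ∑ B : PartitionsInto m 2 with ¬ B.1 a b' ∧ ¬ B.1 b' c', G.forestPoly K B.1 := by
  -- The common value: forests rooted at all marks times spanning trees, neither of which involves
  -- `b` or `c`.
  have key : ∀ b c : Fin m, b ≠ c → algebraMap (MvPolynomial G.Edge K) (RatFun K G)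
      (∑ a with a ≠ b, (∑ A : PartitionsInto m (m - 1) with A.1 a b, G.forestPoly K A.1) *
        ∑ B : PartitionsInto m 2 with ¬ B.1 a b ∧ ¬ B.1 b c, G.forestPoly K B.1) =
      edgeProd K G ^ 2 * (rootedSum (weight K) (Set.range G.mark) *
        ∑ F : Finset G.Edge with G.IsSpanningForest F ∧ (G.spanned F).Connected,
          ∏ e ∈ F, weight K e) := by
    intro b c hbc
    have h1 : ∀ a ∈ Finset.univ.filter (fun a => a ≠ b),
        algebraMap (MvPolynomial G.Edge K) (RatFun K G)
          ((∑ A : PartitionsInto m (m - 1) with A.1 a b, G.forestPoly K A.1) *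
          ∑ B : PartitionsInto m 2 with ¬ B.1 a b ∧ ¬ B.1 b c, G.forestPoly K B.1) =
        edgeProd K G ^ 2 *
          (hitSum (weight K) (Set.range G.mark \ {G.mark b}) (G.mark a) (G.mark b) *
          hitSum (weight K) {G.mark b, G.mark c} (G.mark c) (G.mark a)) := by
      intro a ha
      rw [map_mul, algebraMap_sum_forestPoly_pred K (Finset.mem_filter.1 ha).2,
        algebraMap_sum_forestPoly_two K hbc]
      ring
    rw [map_sum, Finset.sum_congr rfl h1, ← Finset.mul_sum]
    congr 1
    -- Division by this sum fails if no forest is rooted at the marks. Then the first-edge formula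
    -- makes every response entry vanish, and both sides are 0.
    by_cases hT : rootedSum (weight K) (Set.range G.mark) = 0
    · rw [hT, zero_mul]
      refine Finset.sum_eq_zero fun a ha => ?_
      have hab : G.mark a ≠ G.mark b := fun h => (Finset.mem_filter.1 ha).2 (G.mark.injective h)
      have hS : insert (G.mark b) (Set.range G.mark \ {G.mark b}) = Set.range G.mark := by
        rw [Set.insert_sdiff_singleton, Set.insert_eq_of_mem (Set.mem_range_self b)]
      rw [← sum_conductance_mul_hitSum (weight K) (by simp [hab]) (by simp), hS]
      have h0 : ∀ v, hitSum (weight K) (Set.range G.mark) (G.mark a) v = 0 := by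
        intro v
        rw [hitSum, Finset.filter_false_of_mem, Finset.sum_empty]
        exact fun F _ h => rootedSum_weight_eq_zero K hT F h.1
      simp [h0]
    · have h2 := sum_hitSum_mul_hitSum (weight K) (S := Set.range G.mark) (b := G.mark b)
        (c := G.mark c) ⟨b, rfl⟩ ⟨c, rfl⟩ (fun h => hbc (G.mark.injective h))
        (mem_nonZeroDivisors_of_ne_zero hT)
      have h3 : rootedSum (weight K) {G.mark c} = ∑ F : Finset G.Edge with
          G.IsSpanningForest F ∧ (G.spanned F).Connected, ∏ e ∈ F, weight K e := by
        simp only [rootedSum, isRooted_singleton]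
      rw [← h3, ← h2]
      symm
      refine (Finset.sum_congr ?_ fun _ _ => rfl).trans
        (Finset.sum_map (Finset.univ.filter fun a => a ≠ b) G.mark _)
      ext v
      simp only [Finset.mem_filter, Finset.mem_univ, true_and, Finset.mem_map, Set.mem_sdiff,
        Set.mem_range, Set.mem_singleton_iff]
      constructor
      · rintro ⟨⟨a, rfl⟩, h⟩
        exact ⟨a, fun h' => h (congrArg _ h'), rfl⟩
      · rintro ⟨a, h, rfl⟩
        exact ⟨⟨a, rfl⟩, fun h' => h (G.mark.injective h')⟩
  apply IsFractionRing.injective (MvPolynomial G.Edge K) (RatFun K G)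
  rw [key b c hbc, key b' c' hbc']

end MarkedGraph

/-! ### Signs of the minors and the coefficients of `columnRHS`. -/

section Coefficients

variable {m : ℕ}

theorem minorCoeff_of_not {U W : Finset (Fin m)} {P : Setoid (Fin m)}
    (h : ¬ ((∀ x, ∃! u, u ∈ U ∧ P u x) ∧ ∀ x, ∃! w, w ∈ W ∧ P w x)) :
    minorCoeff U W P = 0 := by
  rw [minorCoeff, if_neg h]

theorem minorCoeff_of_forall {U W : Finset (Fin m)} {P : Setoid (Fin m)}
    (hU : ∀ x, ∃! u, u ∈ U ∧ P u x) (hW : ∀ x, ∃! w, w ∈ W ∧ P w x) :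
    minorCoeff U W P = (-1) ^ (∑ u ∈ U, (u : ℕ) + ∑ w ∈ W, (w : ℕ) + inversions U W P) := by
  rw [minorCoeff, if_pos ⟨hU, hW⟩, pow_add _ (_ + _)]

theorem existsUnique_mem_erase {P : Setoid (Fin m)} (hP : Nat.card (Quotient P) = m - 1)
    {a y : Fin m} (hya : y ≠ a) (h : P y a) (x : Fin m) :
    ∃! u, u ∈ Finset.univ.erase a ∧ P u x := by
  have hu := (card_quotient_eq_pred_iff hya h).1 hP
  by_cases hx : x = a
  · subst hx
    refine ⟨y, ⟨by simpa using hya, h⟩, ?_⟩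
    rintro z ⟨hz, hzx⟩
    exact hu z y (by simpa using hz) hya (Setoid.trans' P hzx (Setoid.symm' P h))
  · refine ⟨x, ⟨by simpa using hx, Setoid.refl' P x⟩, ?_⟩
    rintro z ⟨hz, hzx⟩
    exact hu z x (by simpa using hz) hx hzx

theorem exists_ne_of_existsUnique_mem_erase {P : Setoid (Fin m)} {a : Fin m}
    (h : ∀ x, ∃! u, u ∈ Finset.univ.erase a ∧ P u x) : ∃ y, y ≠ a ∧ P y a := by
  obtain ⟨y, ⟨hy, hya⟩, -⟩ := h a
  exact ⟨y, by simpa using hy, hya⟩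

theorem neg_one_pow_sum_erase (a b : Fin m) (k : ℕ) :
    (-1 : ℤ) ^ (∑ u ∈ Finset.univ.erase a, (u : ℕ) + ∑ w ∈ Finset.univ.erase b, (w : ℕ) + k) =
      (-1) ^ ((a : ℕ) + b + k) := by
  have ha := Finset.add_sum_erase Finset.univ (fun u : Fin m => (u : ℕ)) (Finset.mem_univ a)
  have hb := Finset.add_sum_erase Finset.univ (fun u : Fin m => (u : ℕ)) (Finset.mem_univ b)
  apply neg_one_pow_congr
  rw [Nat.even_iff, Nat.even_iff]
  omega

/-- The induced bijection from the complement of `a` to that of `b` sends `b` to `a` and fixes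
everything else. -/
theorem eq_or_of_card_quotient_eq_pred {P : Setoid (Fin m)}
    (hP : Nat.card (Quotient P) = m - 1) {a b u w : Fin m} (hab : a ≠ b) (h : P a b)
    (hu : u ≠ a) (hw : w ≠ b) (huw : P u w) : u = w ∨ (u = b ∧ w = a) := by
  by_cases hne : u = w
  · exact Or.inl hne
  · refine Or.inr ⟨?_, ?_⟩
    · by_contra hub
      exact hne ((card_quotient_eq_pred_iff hab h).1 hP u w hub hw huw)
    · by_contra hwa
      exact hne ((card_quotient_eq_pred_iff hab.symm (Setoid.symm' P h)).1 hP u w hu hwa huw)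

theorem inversions_erase_self {P : Setoid (Fin m)} (hP : Nat.card (Quotient P) = m - 1)
    {b y : Fin m} (hyb : y ≠ b) (h : P y b) :
    inversions (Finset.univ.erase b) (Finset.univ.erase b) P = 0 := by
  rw [inversions, Nat.card_eq_zero]
  refine Or.inl ⟨?_⟩
  rintro ⟨⟨⟨⟨u, hu⟩, ⟨w, hw⟩⟩, ⟨⟨u', hu'⟩, ⟨w', hw'⟩⟩⟩, h1, h2, h3, h4⟩
  have hinj := (card_quotient_eq_pred_iff hyb h).1 hP
  have h1 : P u w := h1
  have h2 : P u' w' := h2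
  have h3 : u < u' := h3
  have h4 : w' < w := h4
  have e1 := hinj u w (by simpa using hu) (by simpa using hw) h1
  have e2 := hinj u' w' (by simpa using hu') (by simpa using hw') h2
  subst e1 e2
  exact absurd h3 h4.asymm

/-- The inversions pair `b ↦ a` with the fixed points strictly between `a` and `b`. Subtraction is
truncated, so one summand is 0. -/
theorem inversions_erase {P : Setoid (Fin m)} (hP : Nat.card (Quotient P) = m - 1)
    {a b : Fin m} (hab : a ≠ b) (h : P a b) :
    inversions (Finset.univ.erase a) (Finset.univ.erase b) P =
      ((b : ℕ) - a - 1) + ((a : ℕ) - b - 1) := by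
  rw [inversions]
  have hba : b ∈ Finset.univ.erase a := by simpa using hab.symm
  have hab' : a ∈ Finset.univ.erase b := by simpa using hab
  rcases lt_or_gt_of_ne hab with hlt | hlt
  · have hz : ∀ z ∈ Finset.Ioo a b, z ∈ Finset.univ.erase a ∧ z ∈ Finset.univ.erase b := by
      intro z hz
      obtain ⟨h1, h2⟩ := Finset.mem_Ioo.1 hz
      exact ⟨by simpa using h1.ne', by simpa using h2.ne⟩
    rw [← Nat.card_eq_of_bijective (α := Finset.Ioo a b)
      (fun z => ⟨((⟨z, (hz z z.2).1⟩, ⟨z, (hz z z.2).2⟩), (⟨b, hba⟩, ⟨a, hab'⟩)),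
        Setoid.refl' P _, Setoid.symm' P h, (Finset.mem_Ioo.1 z.2).2, (Finset.mem_Ioo.1 z.2).1⟩)]
    · have : (a : ℕ) < b := hlt
      rw [Nat.card_eq_fintype_card, Fintype.card_coe, Fin.card_Ioo]
      omega
    · constructor
      · intro z z' hzz
        have := congrArg (fun t => t.1.1.1.1) hzz
        exact Subtype.ext this
      · rintro ⟨⟨⟨⟨u, hu⟩, ⟨w, hw⟩⟩, ⟨⟨u', hu'⟩, ⟨w', hw'⟩⟩⟩, h1, h2, h3, h4⟩
        have d1 : u = w ∨ (u = b ∧ w = a) :=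
          eq_or_of_card_quotient_eq_pred hP hab h (by simpa using hu) (by simpa using hw) h1
        have d2 : u' = w' ∨ (u' = b ∧ w' = a) :=
          eq_or_of_card_quotient_eq_pred hP hab h (by simpa using hu') (by simpa using hw') h2
        have h3 : u < u' := h3
        have h4 : w' < w := h4
        rcases d1 with rfl | ⟨rfl, rfl⟩
        · rcases d2 with rfl | ⟨rfl, rfl⟩
          · exact absurd h3 h4.asymm
          · exact ⟨⟨u, Finset.mem_Ioo.2 ⟨h4, h3⟩⟩, rfl⟩
        · rcases d2 with rfl | ⟨rfl, rfl⟩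
          · exact absurd (lt_trans (b := u') h3 h4) hlt.asymm
          · exact absurd h3 (lt_irrefl _)
  · have hz : ∀ z ∈ Finset.Ioo b a, z ∈ Finset.univ.erase a ∧ z ∈ Finset.univ.erase b := by
      intro z hz
      obtain ⟨h1, h2⟩ := Finset.mem_Ioo.1 hz
      exact ⟨by simpa using h2.ne, by simpa using h1.ne'⟩
    rw [← Nat.card_eq_of_bijective (α := Finset.Ioo b a)
      (fun z => ⟨((⟨b, hba⟩, ⟨a, hab'⟩), (⟨z, (hz z z.2).1⟩, ⟨z, (hz z z.2).2⟩)),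
        Setoid.symm' P h, Setoid.refl' P _, (Finset.mem_Ioo.1 z.2).1, (Finset.mem_Ioo.1 z.2).2⟩)]
    · have : (b : ℕ) < a := hlt
      rw [Nat.card_eq_fintype_card, Fintype.card_coe, Fin.card_Ioo]
      omega
    · constructor
      · intro z z' hzz
        have := congrArg (fun t => t.1.2.1.1) hzz
        exact Subtype.ext this
      · rintro ⟨⟨⟨⟨u, hu⟩, ⟨w, hw⟩⟩, ⟨⟨u', hu'⟩, ⟨w', hw'⟩⟩⟩, h1, h2, h3, h4⟩
        have d1 : u = w ∨ (u = b ∧ w = a) :=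
          eq_or_of_card_quotient_eq_pred hP hab h (by simpa using hu) (by simpa using hw) h1
        have d2 : u' = w' ∨ (u' = b ∧ w' = a) :=
          eq_or_of_card_quotient_eq_pred hP hab h (by simpa using hu') (by simpa using hw') h2
        have h3 : u < u' := h3
        have h4 : w' < w := h4
        rcases d2 with rfl | ⟨rfl, rfl⟩
        · rcases d1 with rfl | ⟨rfl, rfl⟩
          · exact absurd h3 h4.asymm
          · exact ⟨⟨u', Finset.mem_Ioo.2 ⟨h3, h4⟩⟩, rfl⟩
        · rcases d1 with rfl | ⟨rfl, rfl⟩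
          · exact absurd (lt_trans (b := u) h4 h3) hlt.asymm
          · exact absurd h3 (lt_irrefl _)

theorem minorCoeff_erase_self {P : Setoid (Fin m)} (hP : Nat.card (Quotient P) = m - 1)
    {b y : Fin m} (hyb : y ≠ b) (h : P y b) :
    minorCoeff (Finset.univ.erase b) (Finset.univ.erase b) P = 1 := by
  have hU := existsUnique_mem_erase hP hyb h
  rw [minorCoeff_of_forall hU hU, neg_one_pow_sum_erase, inversions_erase_self hP hyb h]
  exact Even.neg_one_pow ⟨b, rfl⟩

theorem minorCoeff_erase {P : Setoid (Fin m)} (hP : Nat.card (Quotient P) = m - 1)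
    {a b : Fin m} (hab : a ≠ b) (h : P a b) :
    minorCoeff (Finset.univ.erase a) (Finset.univ.erase b) P = -1 := by
  rw [minorCoeff_of_forall (existsUnique_mem_erase hP hab.symm (Setoid.symm' P h))
    (existsUnique_mem_erase hP hab h), neg_one_pow_sum_erase, inversions_erase hP hab h]
  have : (a : ℕ) ≠ b := fun h => hab (Fin.ext h)
  refine Odd.neg_one_pow ?_
  rw [Nat.odd_iff]
  omega

theorem minorCoeff_erase_eq_zero {P : Setoid (Fin m)} (hP : Nat.card (Quotient P) = m - 1)
    {a b : Fin m} (hab : a ≠ b) (h : ¬ P a b) :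
    minorCoeff (Finset.univ.erase a) (Finset.univ.erase b) P = 0 := by
  refine minorCoeff_of_not fun hc => ?_
  obtain ⟨y, hya, hy⟩ := exists_ne_of_existsUnique_mem_erase hc.1
  obtain ⟨z, hzb, hz⟩ := exists_ne_of_existsUnique_mem_erase hc.2
  have := (card_quotient_eq_pred_iff hzb hz).1 hP y a (fun hyb => h (hyb ▸ Setoid.symm' P hy)) hab hy
  exact hya this

theorem minorCoeff_erase_eq_zero_of_forall {P : Setoid (Fin m)} {U : Finset (Fin m)} {b : Fin m}
    (h : ∀ y, y ≠ b → ¬ P y b) : minorCoeff U (Finset.univ.erase b) P = 0 := by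
  refine minorCoeff_of_not fun hc => ?_
  obtain ⟨z, hzb, hz⟩ := exists_ne_of_existsUnique_mem_erase hc.2
  exact h z hzb hz

theorem existsUnique_mem_pair_iff {P : Setoid (Fin m)} (hP : Nat.card (Quotient P) = 2)
    {a r : Fin m} (har : a ≠ r) :
    (∀ x, ∃! u, u ∈ ({a, r} : Finset (Fin m)) ∧ P u x) ↔ ¬ P a r := by
  constructor
  · intro h har'
    exact har ((h r).unique ⟨by simp, har'⟩ ⟨by simp, Setoid.refl' P r⟩)
  · intro h x
    rcases (card_quotient_eq_two_iff h).1 hP x with hx | hx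
    · refine ⟨a, ⟨by simp, hx⟩, ?_⟩
      rintro u ⟨hu, hux⟩
      rcases Finset.mem_insert.1 hu with rfl | hu
      · rfl
      · rw [Finset.mem_singleton.1 hu] at hux
        exact absurd (Setoid.trans' P hx (Setoid.symm' P hux)) h
    · refine ⟨r, ⟨by simp, hx⟩, ?_⟩
      rintro u ⟨hu, hux⟩
      rcases Finset.mem_insert.1 hu with rfl | hu
      · exact absurd (Setoid.trans' P hux (Setoid.symm' P hx)) h
      · exact Finset.mem_singleton.1 hu

theorem inversions_pair {P : Setoid (Fin m)} {a r b c : Fin m} (har : a < r) (h : ¬ P a r)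
    (hab : P a b) (hrc : P r c) :
    inversions {a, r} {b, c} P = if c < b then 1 else 0 := by
  have hac : ¬ P a c := fun h' => h (Setoid.trans' P h' (Setoid.symm' P hrc))
  have hrb : ¬ P r b := fun h' => h (Setoid.trans' P hab (Setoid.symm' P h'))
  have key : ∀ u u' w w' : Fin m, u ∈ ({a, r} : Finset (Fin m)) → u' ∈ ({a, r} : Finset (Fin m)) →
      w ∈ ({b, c} : Finset (Fin m)) → w' ∈ ({b, c} : Finset (Fin m)) → P u w → P u' w' → u < u' →
      u = a ∧ w = b ∧ u' = r ∧ w' = c := by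
    intro u u' w w' hu hu' hw hw' h1 h2 h3
    simp only [Finset.mem_insert, Finset.mem_singleton] at hu hu' hw hw'
    rcases hu with rfl | rfl <;> rcases hu' with rfl | rfl
    · exact absurd h3 (lt_irrefl _)
    · rcases hw with rfl | rfl <;> rcases hw' with rfl | rfl <;> simp_all
    · exact absurd h3 har.asymm
    · exact absurd h3 (lt_irrefl _)
  rw [inversions]
  split_ifs with hcb
  · rw [Nat.card_eq_one_iff_unique]
    refine ⟨⟨?_⟩, ⟨⟨((⟨a, by simp⟩, ⟨b, by simp⟩), (⟨r, by simp⟩, ⟨c, by simp⟩)), hab, hrc,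
      har, hcb⟩⟩⟩
    rintro ⟨⟨⟨⟨u, hu⟩, ⟨w, hw⟩⟩, ⟨⟨u', hu'⟩, ⟨w', hw'⟩⟩⟩, h1, h2, h3, h4⟩
      ⟨⟨⟨⟨s, hs⟩, ⟨t, ht⟩⟩, ⟨⟨s', hs'⟩, ⟨t', ht'⟩⟩⟩, k1, k2, k3, k4⟩
    obtain ⟨rfl, rfl, rfl, rfl⟩ := key u u' w w' hu hu' hw hw' h1 h2 h3
    obtain ⟨rfl, rfl, rfl, rfl⟩ := key s s' t t' hs hs' ht ht' k1 k2 k3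
    rfl
  · rw [Nat.card_eq_zero]
    refine Or.inl ⟨?_⟩
    rintro ⟨⟨⟨⟨u, hu⟩, ⟨w, hw⟩⟩, ⟨⟨u', hu'⟩, ⟨w', hw'⟩⟩⟩, h1, h2, h3, h4⟩
    obtain ⟨rfl, rfl, rfl, rfl⟩ := key u u' w w' hu hu' hw hw' h1 h2 h3
    exact hcb h4

open scoped Classical in
-- Only two bijections are possible, `a ↦ b` or `a ↦ c`, and they have opposite signs. The order of
-- `b` and `c` is left open, hence the correction term for `c < b`.
theorem minorCoeff_pair {P : Setoid (Fin m)} (hP : Nat.card (Quotient P) = 2)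
    {a r b c : Fin m} (har : a < r) (hbc : b ≠ c) :
    minorCoeff {a, r} {b, c} P = if ¬ P a r ∧ ¬ P b c then
      (-1) ^ ((a : ℕ) + r + b + c + if c < b then 1 else 0) * (if P a b then 1 else -1) else 0 := by
  by_cases h : ¬ P a r ∧ ¬ P b c
  swap
  · rw [if_neg h]
    refine minorCoeff_of_not fun hc => h ?_
    exact ⟨(existsUnique_mem_pair_iff hP har.ne).1 hc.1, (existsUnique_mem_pair_iff hP hbc).1 hc.2⟩
  rw [if_pos h]
  by_cases hab : P a b
  · rw [if_pos hab]
    have hrc : P r c := by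
      rcases (card_quotient_eq_two_iff h.1).1 hP c with h' | h'
      · exact absurd (Setoid.trans' P (Setoid.symm' P hab) h') h.2
      · exact h'
    rw [minorCoeff_of_forall ((existsUnique_mem_pair_iff hP har.ne).2 h.1)
      ((existsUnique_mem_pair_iff hP hbc).2 h.2), inversions_pair har h.1 hab hrc,
      Finset.sum_pair har.ne, Finset.sum_pair hbc, mul_one]
    ring_nf
  · rw [if_neg hab]
    have hrb : P r b := ((card_quotient_eq_two_iff h.1).1 hP b).resolve_left hab
    have hac : P a c := by
      rcases (card_quotient_eq_two_iff h.1).1 hP c with h' | h'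
      · exact h'
      · exact absurd (Setoid.trans' P (Setoid.symm' P hrb) h') h.2
    rw [minorCoeff_of_forall ((existsUnique_mem_pair_iff hP har.ne).2 h.1)
      ((existsUnique_mem_pair_iff hP hbc).2 h.2), Finset.pair_comm b c,
      inversions_pair har h.1 hac hrb, Finset.sum_pair har.ne, Finset.sum_pair hbc.symm,
      ← pow_succ]
    apply neg_one_pow_congr
    rw [Nat.even_iff, Nat.even_iff]
    rcases lt_or_gt_of_ne hbc with hlt | hlt
    · rw [if_pos hlt, if_neg hlt.asymm]
      omega
    · rw [if_pos hlt, if_neg hlt.asymm]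
      omega

theorem skip_ne (c : Fin m) (i : Fin (m - 1)) : skip c i ≠ c := by
  rw [skip]
  split_ifs with h <;> intro h' <;> have := congrArg Fin.val h' <;> simp only at this <;> omega

theorem skip_injective (c : Fin m) : Function.Injective (skip c) := by
  intro i j h
  have := congrArg Fin.val h
  simp only [skip] at this
  apply Fin.ext
  split_ifs at this <;> simp only at this <;> omega

theorem exists_skip_eq {c b : Fin m} (h : b ≠ c) : ∃ i, skip c i = b := by
  have hne : (b : ℕ) ≠ c := fun h' => h (Fin.ext h')
  rcases lt_or_gt_of_ne hne with hlt | hlt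
  · refine ⟨⟨b, by omega⟩, ?_⟩
    simp [skip, hlt]
  · refine ⟨⟨b - 1, by omega⟩, Fin.ext ?_⟩
    have h1 : ¬ (b : ℕ) - 1 < c := by omega
    simp only [skip, h1, if_false]
    omega

/-- The shift by one past the removed column `c` is exactly compensated by the inversion between `c`
and `skip c j`. -/
theorem neg_one_pow_skip (c : Fin m) (j : Fin (m - 1)) :
    (-1 : ℤ) ^ ((j : ℕ) + skip c j + if c < skip c j then 1 else 0) = 1 := by
  refine Even.neg_one_pow ?_
  rw [Nat.even_iff]
  by_cases h : (j : ℕ) < c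
  · have : skip c j = ⟨j, by omega⟩ := by simp [skip, h]
    rw [this, if_neg (by rw [Fin.lt_def]; simpa using h.le)]
    simp only
    omega
  · have : skip c j = ⟨j + 1, by omega⟩ := by simp [skip, h]
    rw [this, if_pos (by rw [Fin.lt_def]; simp only; omega)]
    simp only
    omega

open scoped Classical in
/-- The coefficients of `columnRHS`, when the last row is removed. -/
theorem columnRHS_apply (K : Type*) [Field K] {r : Fin m} (hr : (r : ℕ) = m - 1) (c : Fin m)
    (j : Fin (m - 1)) (p : PartitionsInto m (m - 1) × PartitionsInto m 2) :
    columnRHS K r c j p =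
      if ∃ a, a ≠ skip c j ∧ p.1.1 a (skip c j) ∧
        ¬ p.2.1 a (skip c j) ∧ ¬ p.2.1 (skip c j) c then 1 else 0 := by
  obtain ⟨⟨A, hA⟩, ⟨B, hB⟩⟩ := p
  set b := skip c j with hb
  have hbc : b ≠ c := skip_ne c j
  -- What remains of the `B`-coefficient once the signs are cancelled; since `r` is last, `skip r i`
  -- has value `i` and lies below `r`.
  set β : Fin m → ℤ := fun a =>
    if ¬ B a r ∧ ¬ B b c then (if B a b then 1 else -1) else 0 with hβ
  have hsum : (-1 : ℤ) ^ ((r : ℕ) + (c : ℕ)) * ∑ i : Fin (m - 1), (-1) ^ ((i : ℕ) + (j : ℕ)) *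
      minorCoeff (Finset.univ.erase (skip r i)) (Finset.univ.erase b) A *
      minorCoeff {skip r i, r} {b, c} B =
      ∑ a, minorCoeff (Finset.univ.erase a) (Finset.univ.erase b) A * β a := by
    rw [Finset.mul_sum]
    refine Finset.sum_of_injOn (skip r) (skip_injective r).injOn (fun _ _ => Finset.mem_coe.2
      (Finset.mem_univ _)) ?_ ?_
    · intro a _ ha
      have har : a = r := by
        by_contra har
        obtain ⟨i, hi⟩ := exists_skip_eq har
        exact ha ⟨i, by simp, hi⟩
      have : β a = 0 := if_neg fun h => h.1 (har ▸ Setoid.refl' B _)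
      rw [this, mul_zero]
    · intro i _
      have hi : ((skip r i : Fin m) : ℕ) = i := by
        rw [skip, if_pos]
        omega
      have hlt : skip r i < r := by
        rw [Fin.lt_def, hi]
        omega
      rw [minorCoeff_pair hB hlt hbc]
      have hs : (-1 : ℤ) ^ ((r : ℕ) + c) * ((-1) ^ ((i : ℕ) + j) *
          (-1) ^ (((skip r i : Fin m) : ℕ) + r + b + c + if c < b then 1 else 0)) = 1 := by
        refine Eq.trans ?_ (neg_one_pow_skip c j)
        rw [← hb, hi, ← pow_add, ← pow_add]
        apply neg_one_pow_congr
        rw [Nat.even_iff, Nat.even_iff]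
        omega
      simp only [hβ]
      by_cases h : ¬ B (skip r i) r ∧ ¬ B b c
      · rw [if_pos h, if_pos h]
        linear_combination (minorCoeff (Finset.univ.erase (skip r i)) (Finset.univ.erase b) A *
          if B (skip r i) b then 1 else -1) * hs
      · rw [if_neg h, if_neg h]
        ring
  have hval : ∑ a, minorCoeff (Finset.univ.erase a) (Finset.univ.erase b) A * β a =
      if ∃ a, a ≠ b ∧ A a b ∧ ¬ B a b ∧ ¬ B b c then 1 else 0 := by
    by_cases hy : ∃ y, y ≠ b ∧ A y b
    · obtain ⟨y, hyb, hy⟩ := hy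
      have hiff : (∃ a, a ≠ b ∧ A a b ∧ ¬ B a b ∧ ¬ B b c) ↔ ¬ B y b ∧ ¬ B b c := by
        refine ⟨?_, fun h => ⟨y, hyb, hy, h⟩⟩
        rintro ⟨a, hab, ha, h⟩
        have : a = y := (card_quotient_eq_pred_iff hyb hy).1 hA a y hab hyb
          (Setoid.trans' A ha (Setoid.symm' A hy))
        exact this ▸ h
      -- Only `b` and its partner `y` in `A` contribute, giving `β b - β y`. The case split on the
      -- part of `B` containing `r` shows that `r` drops out of this difference.
      rw [Fintype.sum_eq_add b y hyb.symm, minorCoeff_erase_self hA hyb hy,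
        minorCoeff_erase hA hyb hy]
      · simp only [hiff, hβ]
        by_cases hBc : B b c
        · simp [hBc]
        have hcl := (card_quotient_eq_two_iff hBc).1 hB
        by_cases hr : B b r
        · by_cases hyb' : B y b
          · have : B y r := Setoid.trans' B hyb' hr
            simp [hr, hyb', this]
          · have : ¬ B y r := fun h => hyb' (Setoid.trans' B h (Setoid.symm' B hr))
            simp [hr, hyb', this, hBc]
        · have hcr : B c r := (hcl r).resolve_left hr
          by_cases hyb' : B y b
          · have : ¬ B y r := fun h => hr (Setoid.trans' B (Setoid.symm' B hyb') h)
            simp [hr, hyb', this, hBc]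
          · have : B y r := Setoid.trans' B (Setoid.symm' B ((hcl y).resolve_left
              fun h => hyb' (Setoid.symm' B h))) hcr
            simp [hr, hyb', this, hBc]
      · rintro a ⟨hab, hay⟩
        rw [minorCoeff_erase_eq_zero hA hab, zero_mul]
        exact fun h => hay ((card_quotient_eq_pred_iff hyb hy).1 hA a y hab hyb
          (Setoid.trans' A h (Setoid.symm' A hy)))
    · rw [if_neg fun ⟨a, hab, ha, _⟩ => hy ⟨a, hab, ha⟩]
      refine Finset.sum_eq_zero fun a _ => ?_
      rw [minorCoeff_erase_eq_zero_of_forall fun y hyb h => hy ⟨y, hyb, h⟩, zero_mul]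
  rw [columnRHS, Finsupp.equivFunOnFinite_symm_apply_apply, hsum, hval]
  split_ifs <;> simp

end Coefficients

/-! ### Membership in `identitySpace` and linear independence. -/

section Independence

variable {m : ℕ} (K : Type*) [Field K]

open scoped Classical in
-- The partner of `skip c j` in `A` is unique, so the existential coefficient is a sum over `a`
-- without multiplicity, and each summand factors.
theorem eval_columnRHS (G : MarkedGraph m) [Fintype (PartitionsInto m (m - 1))]
    [Fintype (PartitionsInto m 2)] {r : Fin m} (hr : (r : ℕ) = m - 1) (c : Fin m)
    (j : Fin (m - 1)) : ABSpace.eval K G (columnRHS K r c j) =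
      ∑ a with a ≠ skip c j,
        (∑ A : PartitionsInto m (m - 1) with A.1 a (skip c j), G.forestPoly K A.1) *
        ∑ B : PartitionsInto m 2 with ¬ B.1 a (skip c j) ∧ ¬ B.1 (skip c j) c,
          G.forestPoly K B.1 := by
  rw [ABSpace.eval, Finsupp.linearCombination_apply, Finsupp.sum_fintype _ _ (by simp)]
  have h1 : ∀ p : PartitionsInto m (m - 1) × PartitionsInto m 2,
      columnRHS K r c j p • (G.forestPoly K p.1.1 * G.forestPoly K p.2.1) =
      ∑ a with a ≠ skip c j, (if p.1.1 a (skip c j) then G.forestPoly K p.1.1 else 0) *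
        (if ¬ p.2.1 a (skip c j) ∧ ¬ p.2.1 (skip c j) c then G.forestPoly K p.2.1 else 0) := by
    intro p
    rw [columnRHS_apply K hr]
    split_ifs with h
    · obtain ⟨a, hab, ha, hB⟩ := h
      rw [Finset.sum_eq_single a, if_pos ha, if_pos hB, one_smul]
      · intro a' ha' hne
        rw [if_neg, zero_mul]
        intro h'
        exact hne ((card_quotient_eq_pred_iff hab ha).1 p.1.2 a' a (Finset.mem_filter.1 ha').2 hab
          (Setoid.trans' _ h' (Setoid.symm' _ ha)))
      · simp [hab]
    · rw [zero_smul, Finset.sum_eq_zero]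
      intro a ha
      by_cases hA : p.1.1 a (skip c j)
      · rw [if_neg fun hB => h ⟨a, (Finset.mem_filter.1 ha).2, hA, hB⟩, mul_zero]
      · rw [if_neg hA, zero_mul]
  rw [Finset.sum_congr rfl fun p _ => h1 p, Finset.sum_comm]
  refine Finset.sum_congr rfl fun a _ => ?_
  rw [Fintype.sum_prod_type, Finset.sum_filter, Finset.sum_filter, Finset.sum_mul_sum]

theorem columnDiff_mem_identitySpace (hm : 3 ≤ m) (c : Fin m) (j : Fin (m - 2)) :
    columnDiff K hm c j ∈ identitySpace K m := by
  classical
  have := Fintype.ofFinite (PartitionsInto m (m - 1))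
  have := Fintype.ofFinite (PartitionsInto m 2)
  refine (Submodule.mem_iInf _).2 fun G => ?_
  rw [LinearMap.mem_ker, columnDiff, map_sub, eval_columnRHS K G rfl, eval_columnRHS K G rfl,
    sub_eq_zero]
  exact G.sum_forestPoly_mul_sum_forestPoly K (skip_ne _ _) (skip_ne _ _)

open scoped Classical in
-- In the witness, `{b, r}` is the only nontrivial part of `A`, and `{r, d}` is a part of `B`. The
-- vertex `skip c j ≠ r` has a partner only if it is `b`; the partner is then `r`, and `B` separates
-- `b` from `c` precisely for `c` in `{r, d}`.
theorem exists_columnRHS_apply_eq {r : Fin m} (hr : (r : ℕ) = m - 1) {b d : Fin m} (hb : b ≠ r)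
    (hbd : b ≠ d) : ∃ p, ∀ (c : Fin m) (j : Fin (m - 1)), skip c j ≠ r →
      columnRHS K r c j p = if skip c j = b ∧ (c = d ∨ c = r) then 1 else 0 := by
  let f : Fin m → Fin m := fun x => if x = r then b else x
  let A : Setoid (Fin m) := Setoid.ker f
  let B : Setoid (Fin m) := Setoid.ker fun x => (x = r ∨ x = d)
  have hfr : f r = b := if_pos rfl
  have hf : ∀ {x}, x ≠ r → f x = x := fun h => if_neg h
  have hA : Nat.card (Quotient A) = m - 1 := by
    refine (card_quotient_eq_pred_iff hb (show A b r from (hf hb).trans hfr.symm)).2 ?_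
    intro i j hi hj hij
    have hij : f i = f j := hij
    rwa [hf hi, hf hj] at hij
  have hBiff : ∀ {x y}, B x y ↔ ((x = r ∨ x = d) ↔ (y = r ∨ y = d)) := fun {x y} => eq_iff_iff
  have hB : Nat.card (Quotient B) = 2 := by
    refine (card_quotient_eq_two_iff (b := b) (c := r) ?_).2 ?_
    · rw [hBiff]
      simp [hb, hbd]
    · intro i
      rw [hBiff, hBiff]
      tauto
  refine ⟨(⟨A, hA⟩, ⟨B, hB⟩), fun c j hj => ?_⟩
  rw [columnRHS_apply K hr]
  refine if_congr ?_ rfl rfl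
  simp only [hBiff]
  constructor
  · rintro ⟨a, ha, haA, haB, hc⟩
    have haA : f a = f (skip c j) := haA
    rw [hf hj] at haA
    by_cases har : a = r
    · rw [har, hfr] at haA
      rw [← haA] at hc ⊢
      simp only [hb, hbd, false_or, false_iff, not_not] at hc
      exact ⟨rfl, hc.symm⟩
    · rw [hf har] at haA
      exact absurd haA ha
  · rintro ⟨rfl, hc⟩
    refine ⟨r, hj.symm, ?_, ?_, ?_⟩
    · exact hfr.trans (hf hj).symm
    · simp [hb, hbd]
    · simp [hb, hbd, hc.symm]

open scoped Classical in
theorem exists_dual_columnRHS {r : Fin m} (hr : (r : ℕ) = m - 1) {b d : Fin m} (hb : b ≠ r)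
    (hbd : b ≠ d) : ∃ l : ABSpace K m →ₗ[K] K, ∀ (c : Fin m) (j : Fin (m - 1)), skip c j ≠ r →
      l (columnRHS K r c j) = if skip c j = b ∧ c = d then 1 else 0 := by
  -- The choice `d = r` detects `c = r` alone; subtracting it from the coefficient for `d` removes
  -- the unwanted case `c = r`.
  obtain ⟨p, hp⟩ := exists_columnRHS_apply_eq K hr hb hb
  by_cases hd : d = r
  · refine ⟨Finsupp.lapply p, fun c j hj => ?_⟩
    rw [Finsupp.lapply_apply, hp c j hj, hd]
    simp only [or_self]
  · obtain ⟨q, hq⟩ := exists_columnRHS_apply_eq K hr hb hbd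
    refine ⟨Finsupp.lapply q - Finsupp.lapply p, fun c j hj => ?_⟩
    rw [LinearMap.sub_apply, Finsupp.lapply_apply, Finsupp.lapply_apply, hp c j hj, hq c j hj]
    simp only [or_self]
    by_cases hc : c = r
    · have : c ≠ d := fun h => hd (h ▸ hc)
      simp [hc, Ne.symm hd]
    · simp [hc]

theorem skip_ne_last (hm : 3 ≤ m) (c : Fin m) (j : Fin (m - 2)) :
    skip c ⟨j, by omega⟩ ≠ ⟨m - 1, by omega⟩ := by
  intro h
  have := congrArg Fin.val h
  rw [skip] at this
  split_ifs at this <;> simp only at this <;> omega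

theorem linearIndependent_columnDiff (hm : 3 ≤ m) :
    LinearIndependent K (fun p : Fin m × Fin (m - 2) => columnDiff K hm p.1 p.2) := by
  classical
  rw [Fintype.linearIndependent_iff]
  intro g hg p
  obtain ⟨l, hl⟩ := exists_dual_columnRHS K (r := ⟨m - 1, by omega⟩) rfl
    (skip_ne_last hm p.1 p.2) (skip_ne p.1 ⟨p.2, by omega⟩)
  -- The subtracted element has position `m - 2` counted from 0, just beyond the range of `p.2`, so
  -- it is never the one that `l` detects.
  have h0 : l (columnRHS K ⟨m - 1, by omega⟩ ⟨m - 1, by omega⟩ ⟨m - 2, by omega⟩) = 0 := by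
    rw [hl _ _ (skip_ne _ _), if_neg]
    rintro ⟨h1, h2⟩
    rw [← h2] at h1
    have := congrArg Fin.val (skip_injective _ h1)
    simp only at this
    omega
  have h1 : ∀ q : Fin m × Fin (m - 2), l (columnDiff K hm q.1 q.2) = if q = p then 1 else 0 := by
    intro q
    rw [columnDiff, map_sub, h0, sub_zero, hl _ _ (skip_ne_last hm q.1 q.2)]
    refine if_congr ⟨?_, ?_⟩ rfl rfl
    · rintro ⟨h1, h2⟩
      rw [h2] at h1
      have := congrArg Fin.val (skip_injective _ h1)
      exact Prod.ext h2 (Fin.ext this)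
    · rintro rfl
      exact ⟨rfl, rfl⟩
  have := congrArg l hg
  rw [map_sum, map_zero] at this
  simpa [h1] using this

end Independence

theorem proposition3p3 (K : Type*) [Field K] (m : ℕ) (hm : 3 ≤ m) :
    LinearIndependent K (fun p : Fin m × Fin (m - 2) => columnDiff K hm p.1 p.2) ∧
    ∃ hX : ∀ p : Fin m × Fin (m - 2), columnDiff K hm p.1 p.2 ∈ identitySpace K m,
      LinearIndependent K (fun p : Fin m × Fin (m - 2) =>
        (⟨columnDiff K hm p.1 p.2, hX p⟩ : identitySpace K m)) := by
  refine ⟨linearIndependent_columnDiff K hm,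
    fun p => columnDiff_mem_identitySpace K hm p.1 p.2, ?_⟩
  exact LinearIndependent.of_comp (identitySpace K m).subtype (linearIndependent_columnDiff K hm)
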